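/- Let $n,k$ be natural numbers with $k\le n-1$, let $U=\{1,\dots,n\}$ be a set of users, let $U^H\subseteq U$ be the set of honest users (the other users are malicious), $n_H=|U^H|$ and $\rho=n_H/n$. Let $\varepsilon,\delta\in(0,1)$ and $\sigma_\eta,\sigma_\Delta>0$. GOPA on a random $k$-out graph is the following process, for private values $X=(X_u)_{u\in U}\in[0,1]^n$. Each honest user selects, independently of the other honest users, a uniformly random set of $k$ users other than itself. The malicious users select arbitrary sets of users, possibly at random and depending on the selections of the honest users. The graph $G=(U,E)$ has the edge $\{u,v\}$, $u\ne v$, iff $u$ selected $v$ or $v$ selected $u$. Then, independently of $G$, draw independent $\Delta_{u,v}\sim\mathcal N(0,\sigma_\Delta^2)$ for $\{u,v\}\in E$ with $u<v$, put $\Delta_{v,u}=-\Delta_{u,v}$, and draw independent $\eta_u\sim\mathcal N(0,\sigma_\eta^2)$ for $u\in U$; each user $u$ publishes $\hat X_u=X_u+\sum_{v:\{u,v\}\in E}\Delta_{u,v}+\eta_u$. The output is the view of the adversary: the graph $G$, all noisy values $\hat X_u$, the values $X_u$ and $\eta_u$ of the malicious users, and all $\Delta_{u,v}$ for which $u$ or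 $v$ is malicious. Suppose that $$\rho n\ge 81,\quad \rho k\ge 4\log\frac{2\rho n}{3\delta},\quad \rho k\ge 6\log\frac{\rho n}{3},\quad \rho k\ge \frac32+\frac94\log\frac{2e}{\delta},$$ and put $$\theta=\frac{1}{n_H\sigma_\eta^2}+\Big(\frac{1}{\lfloor (k-1)\rho/3\rfloor-1}+\frac{12+6\log n_H}{n_H}\Big)\frac1{\sigma_\Delta^2}.$$ If $$\varepsilon\ge \frac{\theta}{2}+\theta^{1/2}\qquad\text{and}\qquad \Big(\varepsilon-\frac{\theta}{2}\Big)^2\ge 2\log\Big(\frac{2}{\delta\sqrt{2\pi}}\Big)\,\theta,$$ then this process is $(\varepsilon,3\delta)$-differentially private: for all $X,X'\in[0,1]^n$ that differ only in the value of one honest user, and every measurable set $\mathcal O$ of outputs, $$\Pr[\text{output on }X\in\mathcal O]\le e^{\varepsilon}\,\Pr[\text{output on }X'\in\mathcal O]+3\delta .$$ -/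

import Mathlib

open MeasureTheory ProbabilityTheory
open scoped NNReal ENNReal

namespace Gopa

/-- `(ε, δ)`-differential privacy of a randomized mechanism `M`, given by the law `M X` of its
output on the dataset `X`, with respect to a relation `nbr` of neighbouring datasets. -/
def IsDP {D Ω : Type*} [MeasurableSpace Ω] (nbr : D → D → Prop) (M : D → Measure Ω)
    (ε δ : ℝ) : Prop :=
  ∀ X X' : D, nbr X X' → ∀ O : Set Ω, MeasurableSet O →
    M X O ≤ ENNReal.ofReal (Real.exp ε) * M X' O + ENNReal.ofReal δ

/-- The private values of the `n` users, each in `[0, 1]`. -/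
abbrev Dataset (n : ℕ) : Type := Fin n → Set.Icc (0 : ℝ) 1

/-- Two datasets that differ at most in the value of one honest user. -/
def HonestNeighbors {n : ℕ} (H : Finset (Fin n)) (X X' : Dataset n) : Prop :=
  ∃ v ∈ H, ∀ u, u ≠ v → X u = X' u

/-! ### The communication graph -/

/-- The possible joint selections of the honest users: each of them selects `k` other users. -/
def honestSelections {n : ℕ} (H : Finset (Fin n)) (k : ℕ) :
    Finset ({u // u ∈ H} → Finset (Fin n)) :=
  Fintype.piFinset fun u => (Finset.univ.erase u.1).powersetCard k

theorem honestSelections_nonempty {n : ℕ} (H : Finset (Fin n)) {k : ℕ} (hk : k < n) :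
    (honestSelections H k).Nonempty := by
  refine Fintype.piFinset_nonempty.2 fun u => Finset.powersetCard_nonempty.2 ?_
  rw [Finset.card_erase_of_mem (Finset.mem_univ _), Finset.card_univ, Fintype.card_fin]
  omega

/-- A selection strategy of the malicious users: given the selections of the honest users, an
arbitrary law for the sets of users that the malicious users select. -/
abbrev Strategy {n : ℕ} (H : Finset (Fin n)) : Type :=
  ({u // u ∈ H} → Finset (Fin n)) → PMF ({u // u ∉ H} → Finset (Fin n))

/-- The law of the selections of all users. The honest users select independently and uniformly
(equivalently, their joint selection is uniform on the product set `honestSelections H k`), the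
malicious users follow the strategy `adv`. -/
noncomputable def selectionLaw {n : ℕ} (H : Finset (Fin n)) (k : ℕ) (hk : k < n)
    (adv : Strategy H) : PMF (Fin n → Finset (Fin n)) :=
  (PMF.uniformOfFinset (honestSelections H k) (honestSelections_nonempty H hk)).bind fun c =>
    (adv c).map fun d u => if h : u ∈ H then c ⟨u, h⟩ else d ⟨u, h⟩

/-- The communication graph: distinct users `u`, `v` are adjacent iff `u` selected `v` or `v`
selected `u` (or both). -/
def graphOf {n : ℕ} (c : Fin n → Finset (Fin n)) : SimpleGraph (Fin n) :=
  SimpleGraph.fromRel fun u v => v ∈ c u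

/-! ### The protocol -/

open Classical in
/-- The pairwise noise term `Δ_{u,v}`. For an edge `{u, v}` with `u < v` the user `u` adds the
number `x s(u, v)` and the user `v` subtracts it; the numbers attached to non-edges are not used. -/
noncomputable def pairNoise {n : ℕ} (G : SimpleGraph (Fin n)) (x : Sym2 (Fin n) → ℝ)
    (u v : Fin n) : ℝ :=
  if G.Adj u v then (if u < v then x s(u, v) else -x s(u, v)) else 0

/-- The noisy value `X_u + ∑_{v ∈ N(u)} Δ_{u,v} + η_u` that user `u` reveals. -/
noncomputable def noisyValue {n : ℕ} (G : SimpleGraph (Fin n)) (X : Dataset n) (η : Fin n → ℝ)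
    (x : Sym2 (Fin n) → ℝ) (u : Fin n) : ℝ :=
  (X u : ℝ) + ∑ v, pairNoise G x u v + η u

/-- What the adversary observes, in this order: the graph, the noisy values of all users, the
private values of the malicious users, the independent noise of the malicious users, and the
pairwise noise terms in which a malicious user takes part. -/
abbrev View {n : ℕ} (H : Finset (Fin n)) : Type :=
  SimpleGraph (Fin n) × (Fin n → ℝ) × ({u // u ∉ H} → ℝ) × ({u // u ∉ H} → ℝ) ×
    ({u // u ∉ H} → Fin n → ℝ)

/-- The view of the adversary as a function of the graph, the private values and the noise. -/
noncomputable def view {n : ℕ} (H : Finset (Fin n)) (G : SimpleGraph (Fin n)) (X : Dataset n)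
    (η : Fin n → ℝ) (x : Sym2 (Fin n) → ℝ) : View H :=
  (G, noisyValue G X η x, fun u => (X u.1 : ℝ), fun u => η u.1, fun u v => pairNoise G x u.1 v)

/-- The law of the adversary's view of the protocol run on a fixed graph: all noise variables are
independent centred Gaussians, the `η_u` of variance `ση ^ 2`, the pairwise ones of variance
`σΔ ^ 2`. -/
noncomputable def gopaOn {n : ℕ} (H : Finset (Fin n)) (ση σΔ : ℝ≥0) (G : SimpleGraph (Fin n))
    (X : Dataset n) : Measure (View H) :=
  ((Measure.pi fun _ : Fin n => gaussianReal 0 (ση ^ 2)).prod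
    (Measure.pi fun _ : Sym2 (Fin n) => gaussianReal 0 (σΔ ^ 2))).map
      fun ω => view H G X ω.1 ω.2

/-- The law of the adversary's view of the whole process: generation of the random `k`-out graph,
followed by the protocol on that graph. -/
noncomputable def gopaKOut {n : ℕ} (H : Finset (Fin n)) (k : ℕ) (hk : k < n) (adv : Strategy H)
    (ση σΔ : ℝ≥0) (X : Dataset n) : Measure (View H) :=
  Measure.sum fun c : Fin n → Finset (Fin n) =>
    selectionLaw H k hk adv c • gopaOn H ση σΔ (graphOf c) X

end Gopa

namespace Gopa

/-! ### Shifts of Gaussian product measures -/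

/-! Fix the graph and suppose only the value of the honest user `v` changes, by `D` with `|D| ≤ 1`.
If a unit flow `y` from `v` to the uniform distribution on the honest users runs along honest edges,
then adding `D * y` to the pairwise noise and `D / n_H` to the independent noise of every honest
user turns the view on `X'` into the view on `X` (`view_shift`). Changing the dataset is therefore a
translation of a Gaussian vector, of squared length at most `1 / (n_H ση²) + ‖y‖² / σΔ²` in units of
the variances. If this is at most `θ`, a Chernoff bound on the log likelihood ratio
(`gaussianPi_shift_le`) and the calibration of `ε` leave an additive error of at most `1.3 δ`.

It remains to find a flow of small energy. By duality (`exists_honestFlow`) the energy can be taken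
at most `R` as soon as `(f v - mean f)² ≤ R * dirichlet f` for every potential `f`. Such a bound
follows from a large honest degree of `v` together with expansion among the honest users
(`Expands.potential_bound`): cut the range of `f` at quantiles whose ranks double, first from `v`
down to the median, then from the minimum up to it. Expansion puts many edges across each gap, and
an edge crosses disjoint gaps, so its squared drop dominates the sum of their squares.
Cauchy–Schwarz then gives a geometrically convergent sum plus terms of order `log n_H / n_H`.

Degree and expansion hold with high probability over the honest selections alone, whatever the
malicious users do. Write `L = ρ k`. The degree of `v` is below `0.78 L` with probability at most
`0.2 δ`. Some pair `A ⊆ Q` receives fewer than an eighth of the expected selections from `A` to `H \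
Q` with probability at most `δ`, by a union bound in which sets `A` of size `a` contribute `δ / 2 ^
a`. With these two properties `energy_bound_le` bounds the energy by the bracket in `θ`, and the
errors add up to `2.5 δ ≤ 3 δ`. -/

theorem lintegral_pi_prod {ι : Type*} [Fintype ι] (μ : ι → Measure ℝ)
    [∀ i, IsProbabilityMeasure (μ i)] (g : ι → ℝ → ℝ≥0∞) (hg : ∀ i, Measurable (g i)) :
    ∫⁻ x, ∏ i, g i (x i) ∂(Measure.pi μ) = ∏ i, ∫⁻ y, g i y ∂(μ i) := by
  have h := lintegral_prod_eq_prod_lintegral_of_indepFun (μ := Measure.pi μ) Finset.univ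
    (fun i x => g i (x i)) (iIndepFun_pi fun i => (hg i).aemeasurable)
    (fun i => (hg i).comp (measurable_pi_apply i))
  rw [h]
  refine Finset.prod_congr rfl fun i _ => ?_
  exact (measurePreserving_eval μ i).lintegral_comp (hg i)

theorem gaussianReal_withDensity_shift {v : ℝ≥0} (hv : v ≠ 0) (t : ℝ) :
    (gaussianReal 0 v).withDensity (fun x => ENNReal.ofReal (Real.exp ((t * x - t ^ 2 / 2) / v))) =
      gaussianReal t v := by
  have hv' : (v : ℝ) ≠ 0 := by exact_mod_cast hv
  rw [gaussianReal_of_var_ne_zero _ hv, gaussianReal_of_var_ne_zero _ hv,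
    ← withDensity_mul _ (measurable_gaussianPDF 0 v) (by fun_prop)]
  congr 1
  ext x
  rw [Pi.mul_apply, gaussianPDF, gaussianPDF, ← ENNReal.ofReal_mul (gaussianPDFReal_nonneg _ _ _),
    gaussianPDFReal, gaussianPDFReal, mul_assoc, ← Real.exp_add]
  congr 3
  field_simp
  ring

/-- The exponent is `c` times the log likelihood ratio between the means `t` and `0`, so this is its
moment generating function, the input to the Chernoff bound. -/
theorem lintegral_exp_shift_gaussianReal {v : ℝ≥0} (hv : v ≠ 0) (t c : ℝ) :
    ∫⁻ x, ENNReal.ofReal (Real.exp (c * ((t * x - t ^ 2 / 2) / v))) ∂(gaussianReal 0 v) =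
      ENNReal.ofReal (Real.exp ((c ^ 2 - c) * (t ^ 2 / v) / 2)) := by
  have hv' : (v : ℝ) ≠ 0 := by exact_mod_cast hv
  have h1 : ∀ x : ℝ, Real.exp (c * ((t * x - t ^ 2 / 2) / v)) =
      Real.exp (-(c * t ^ 2 / 2 / v)) * Real.exp ((c * t / v) * x) := by
    intro x
    rw [← Real.exp_add]
    congr 1
    field_simp
    ring
  have h2 := congrFun (mgf_id_gaussianReal (μ := 0) (v := v)) (c * t / v)
  simp only [mgf, id] at h2
  simp_rw [h1]
  rw [← ofReal_integral_eq_lintegral_ofReal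
    ((integrable_exp_mul_gaussianReal _).const_mul _)
    (Filter.Eventually.of_forall fun x => by positivity), integral_const_mul, h2, ← Real.exp_add]
  congr 2
  field_simp
  ring

variable {ι : Type*} [Fintype ι]

theorem gaussianPi_map_add (v : ι → ℝ≥0) (hv : ∀ i, v i ≠ 0) (t : ι → ℝ) :
    (Measure.pi fun i => gaussianReal 0 (v i)).map (fun x => x + t) =
      (Measure.pi fun i => gaussianReal 0 (v i)).withDensity fun x =>
        ∏ i, ENNReal.ofReal (Real.exp ((t i * x i - t i ^ 2 / 2) / v i)) := by
  have h1 : (Measure.pi fun i => gaussianReal (t i) (v i)) =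
      (Measure.pi fun i => gaussianReal 0 (v i)).map (fun x => x + t) := by
    have := Measure.pi_map_pi (μ := fun i => gaussianReal 0 (v i)) (f := fun i x => x + t i)
      (fun i => by fun_prop)
    simp only [gaussianReal_map_add_const, zero_add] at this
    exact this.symm
  rw [← h1]
  refine Measure.pi_eq fun s hs => ?_
  rw [withDensity_apply _ (MeasurableSet.univ_pi hs), ← lintegral_indicator (MeasurableSet.univ_pi hs)]
  have h2 : ∀ x : ι → ℝ, (Set.univ.pi s).indicator (fun x =>
      ∏ i, ENNReal.ofReal (Real.exp ((t i * x i - t i ^ 2 / 2) / v i))) x =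
      ∏ i, (s i).indicator (fun y =>
        ENNReal.ofReal (Real.exp ((t i * y - t i ^ 2 / 2) / v i))) (x i) := by
    intro x
    by_cases hx : x ∈ Set.univ.pi s
    · rw [Set.indicator_of_mem hx]
      refine Finset.prod_congr rfl fun i _ => ?_
      rw [Set.indicator_of_mem (hx i (Set.mem_univ i))]
    · rw [Set.indicator_of_notMem hx]
      simp only [Set.mem_pi, Set.mem_univ, true_implies, not_forall] at hx
      obtain ⟨i, hi⟩ := hx
      exact (Finset.prod_eq_zero (Finset.mem_univ i) (Set.indicator_of_notMem hi _)).symm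
  simp_rw [h2]
  rw [lintegral_pi_prod _ _ fun i => Measurable.indicator (by fun_prop) (hs i)]
  refine Finset.prod_congr rfl fun i _ => ?_
  rw [lintegral_indicator (hs i), ← withDensity_apply _ (hs i),
    gaussianReal_withDensity_shift (hv i)]

/-- The Gaussian mechanism for independent coordinates with individual variances: shifting the
noise changes probabilities by a factor `exp ε` and a Chernoff tail. -/
theorem gaussianPi_shift_le (v : ι → ℝ≥0) (hv : ∀ i, v i ≠ 0) (t : ι → ℝ) {θ ε : ℝ} (hθ : 0 < θ)
    (ht : ∑ i, t i ^ 2 / v i ≤ θ) (hε : θ / 2 ≤ ε) {S : Set (ι → ℝ)} (hS : MeasurableSet S) :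
    (Measure.pi fun i => gaussianReal 0 (v i)) ((fun x => x + t) ⁻¹' S) ≤
      ENNReal.ofReal (Real.exp ε) * (Measure.pi fun i => gaussianReal 0 (v i)) S +
        ENNReal.ofReal (Real.exp (-((ε - θ / 2) ^ 2 / (2 * θ)))) := by
  set γ := Measure.pi fun i => gaussianReal 0 (v i) with hγ
  set D : (ι → ℝ) → ℝ≥0∞ := fun x =>
    ∏ i, ENNReal.ofReal (Real.exp ((t i * x i - t i ^ 2 / 2) / v i)) with hD
  have hDm : Measurable D := by
    refine Finset.measurable_prod _ fun i _ => ?_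
    fun_prop
  have hmap := gaussianPi_map_add v hv t
  rw [← Measure.map_apply (by fun_prop) hS, hmap]
  set E : ℝ≥0∞ := ENNReal.ofReal (Real.exp ε) with hE
  have hT : MeasurableSet {x | E ≤ D x} := measurableSet_le measurable_const hDm
  have hsplit : γ.withDensity D S ≤ γ.withDensity D (S \ {x | E ≤ D x}) +
      γ.withDensity D {x | E ≤ D x} := by
    refine (measure_mono ?_).trans (measure_union_le _ _)
    intro x hx
    by_cases h : E ≤ D x
    · exact Or.inr h
    · exact Or.inl ⟨hx, h⟩
  refine hsplit.trans (add_le_add ?_ ?_)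
  · rw [withDensity_apply _ (hS.diff hT)]
    calc ∫⁻ x in S \ {x | E ≤ D x}, D x ∂γ ≤ ∫⁻ _ in S \ {x | E ≤ D x}, E ∂γ := by
          refine setLIntegral_mono measurable_const fun x hx => ?_
          exact (not_le.1 hx.2).le
      _ = E * γ (S \ {x | E ≤ D x}) := by rw [setLIntegral_const]
      _ ≤ E * γ S := by gcongr; exact Set.sdiff_subset
  -- Where `D ≥ exp ε`, one has `D ≤ exp (-l ε) * D ^ (1 + l)` for every `l ≥ 0`. This `l` minimises
  -- the resulting exponent `-l ε + (l ^ 2 + l) θ / 2`.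
  · set l : ℝ := (ε - θ / 2) / θ with hl
    have hl0 : 0 ≤ l := div_nonneg (by linarith) hθ.le
    have hDexp : ∀ x, D x = ENNReal.ofReal (Real.exp (∑ i, (t i * x i - t i ^ 2 / 2) / v i)) := by
      intro x
      rw [hD, Real.exp_sum, ENNReal.ofReal_prod_of_nonneg fun i _ => (Real.exp_pos _).le]
    rw [withDensity_apply _ hT]
    calc ∫⁻ x in {x | E ≤ D x}, D x ∂γ
        ≤ ∫⁻ x in {x | E ≤ D x}, ENNReal.ofReal (Real.exp (-(l * ε))) *
            ∏ i, ENNReal.ofReal (Real.exp ((1 + l) * ((t i * x i - t i ^ 2 / 2) / v i))) ∂γ := by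
          refine setLIntegral_mono (by
            refine Measurable.const_mul (Finset.measurable_prod _ fun i _ => ?_) _
            fun_prop) fun x hx => ?_
          have hx' : ε ≤ ∑ i, (t i * x i - t i ^ 2 / 2) / v i := by
            have : E ≤ D x := hx
            rw [hDexp, hE, ENNReal.ofReal_le_ofReal_iff (Real.exp_pos _).le, Real.exp_le_exp] at this
            exact this
          rw [hDexp, ← ENNReal.ofReal_prod_of_nonneg fun i _ => (Real.exp_pos _).le,
            ← Real.exp_sum, ← ENNReal.ofReal_mul (Real.exp_pos _).le, ← Real.exp_add]
          refine ENNReal.ofReal_le_ofReal (Real.exp_le_exp.2 ?_)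
          rw [← Finset.mul_sum]
          nlinarith
      _ ≤ ∫⁻ x, ENNReal.ofReal (Real.exp (-(l * ε))) *
            ∏ i, ENNReal.ofReal (Real.exp ((1 + l) * ((t i * x i - t i ^ 2 / 2) / v i))) ∂γ :=
          setLIntegral_le_lintegral _ _
      _ = ENNReal.ofReal (Real.exp (-(l * ε))) *
            ∏ i, ENNReal.ofReal (Real.exp (((1 + l) ^ 2 - (1 + l)) * (t i ^ 2 / v i) / 2)) := by
          rw [lintegral_const_mul _ (Finset.measurable_prod _ fun i _ => by fun_prop), hγ,
            lintegral_pi_prod (fun i => gaussianReal 0 (v i))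
              (fun i y => ENNReal.ofReal (Real.exp ((1 + l) * ((t i * y - t i ^ 2 / 2) / v i))))
              fun i => by fun_prop]
          simp_rw [lintegral_exp_shift_gaussianReal (hv _)]
      _ ≤ _ := by
          rw [← ENNReal.ofReal_prod_of_nonneg fun i _ => (Real.exp_pos _).le, ← Real.exp_sum,
            ← ENNReal.ofReal_mul (Real.exp_pos _).le, ← Real.exp_add]
          refine ENNReal.ofReal_le_ofReal (Real.exp_le_exp.2 ?_)
          rw [← Finset.sum_div, ← Finset.mul_sum]
          have h3 : ((1 + l) ^ 2 - (1 + l)) * ∑ i, t i ^ 2 / v i ≤ (l ^ 2 + l) * θ := by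
            have : (1 + l) ^ 2 - (1 + l) = l ^ 2 + l := by ring
            rw [this]
            exact mul_le_mul_of_nonneg_left ht (by positivity)
          have h4 : -((ε - θ / 2) ^ 2 / (2 * θ)) = -(l * ε) + (l ^ 2 + l) * θ / 2 := by
            rw [hl]; field_simp; ring
          rw [h4]; linarith

/-! ### Privacy on a fixed graph from a flow between honest users -/

theorem pairNoise_add {n : ℕ} (G : SimpleGraph (Fin n)) (x y : Sym2 (Fin n) → ℝ) (u v : Fin n) :
    pairNoise G (x + y) u v = pairNoise G x u v + pairNoise G y u v := by
  unfold pairNoise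
  split_ifs
  · rfl
  · simp only [Pi.add_apply]; ring
  · simp

theorem measurable_view {n : ℕ} (H : Finset (Fin n)) (G : SimpleGraph (Fin n)) (X : Dataset n) :
    Measurable fun ω : (Fin n → ℝ) × (Sym2 (Fin n) → ℝ) => view H G X ω.1 ω.2 := by
  have hp : ∀ u v, Measurable fun ω : (Fin n → ℝ) × (Sym2 (Fin n) → ℝ) =>
      pairNoise G ω.2 u v := by
    intro u v
    unfold pairNoise
    split_ifs <;> fun_prop
  have hn : ∀ u, Measurable fun ω : (Fin n → ℝ) × (Sym2 (Fin n) → ℝ) =>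
      noisyValue G X ω.1 ω.2 u := by
    intro u
    unfold noisyValue
    exact (measurable_const.add (Finset.measurable_sum _ fun v _ => hp u v)).add (by fun_prop)
  unfold view
  refine measurable_const.prodMk ((measurable_pi_lambda _ hn).prodMk
    (measurable_const.prodMk (Measurable.prodMk (by fun_prop) ?_)))
  exact measurable_pi_lambda _ fun u => measurable_pi_lambda _ fun v => hp u.1 v

/-- `y` carries a unit from `v` to the uniform distribution on the honest users, along edges
between honest users. -/
structure IsHonestFlow {n : ℕ} (H : Finset (Fin n)) (G : SimpleGraph (Fin n)) (v : Fin n)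
    (y : Sym2 (Fin n) → ℝ) : Prop where
  support : ∀ u ∉ H, ∀ w, y s(u, w) = 0
  div : ∀ u ∈ H, ∑ w, pairNoise G y u w = (if u = v then 1 else 0) - 1 / (H.card : ℝ)

theorem IsHonestFlow.pairNoise_eq_zero {n : ℕ} {H : Finset (Fin n)} {G : SimpleGraph (Fin n)}
    {v : Fin n} {y : Sym2 (Fin n) → ℝ} (hy : IsHonestFlow H G v y) {u : Fin n} (hu : u ∉ H)
    (w : Fin n) : pairNoise G y u w = 0 := by
  unfold pairNoise
  simp [hy.support u hu w]

theorem pairNoise_smul {n : ℕ} (G : SimpleGraph (Fin n)) (a : ℝ) (y : Sym2 (Fin n) → ℝ)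
    (u v : Fin n) : pairNoise G (a • y) u v = a * pairNoise G y u v := by
  unfold pairNoise
  split_ifs <;> simp

/-- At `v` the shift adds `D (1 - 1/n_H)` through the flow and `D / n_H` through `η`, in total `D`;
at any other honest user `-D / n_H` and `D / n_H` cancel. Malicious users see nothing because the
flow avoids their edges. -/
theorem view_shift {n : ℕ} {H : Finset (Fin n)} {G : SimpleGraph (Fin n)} {v : Fin n}
    (hv : v ∈ H) {y : Sym2 (Fin n) → ℝ} (hy : IsHonestFlow H G v y) {X X' : Dataset n}
    (hX : ∀ u, u ≠ v → X u = X' u) (η : Fin n → ℝ) (x : Sym2 (Fin n) → ℝ) :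
    view H G X η x = view H G X'
      (η + fun u => if u ∈ H then ((X v : ℝ) - X' v) / H.card else 0)
      (x + ((X v : ℝ) - X' v) • y) := by
  set D : ℝ := (X v : ℝ) - X' v with hD
  have hne : ∀ u, u ∉ H → u ≠ v := fun u hu h => hu (h ▸ hv)
  unfold view
  refine Prod.ext rfl (Prod.ext ?_ (Prod.ext ?_ (Prod.ext ?_ ?_)))
  · funext u
    simp only [noisyValue, pairNoise_add, pairNoise_smul, Finset.sum_add_distrib, ← Finset.mul_sum,
      Pi.add_apply]
    by_cases hu : u ∈ H
    · rw [hy.div u hu, if_pos hu]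
      by_cases huv : u = v
      · subst huv
        rw [if_pos rfl, hD]
        ring
      · rw [if_neg huv, hX u huv]
        ring
    · rw [if_neg hu, hX u (hne u hu), Finset.sum_eq_zero fun w _ => hy.pairNoise_eq_zero hu w]
      ring
  · funext u
    simp only [hX u.1 (hne u.1 u.2)]
  · funext u
    simp [u.2]
  · funext u w
    simp [pairNoise_add, pairNoise_smul, hy.pairNoise_eq_zero u.2]

/-- Merges the two noise families into one product over a sum type, the form that
`gaussianPi_shift_le` requires. -/
theorem gopaOn_apply {n : ℕ} (H : Finset (Fin n)) (ση σΔ : ℝ≥0) (G : SimpleGraph (Fin n))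
    (X : Dataset n) {O : Set (View H)} (hO : MeasurableSet O) :
    gopaOn H ση σΔ G X O =
      (Measure.pi fun i : Fin n ⊕ Sym2 (Fin n) =>
        gaussianReal 0 (Sum.elim (fun _ => ση ^ 2) (fun _ => σΔ ^ 2) i))
        {z | view H G X (fun u => z (Sum.inl u)) (fun e => z (Sum.inr e)) ∈ O} := by
  unfold gopaOn
  rw [Measure.map_apply (measurable_view H G X) hO]
  have h := measurePreserving_sumPiEquivProdPi (ι := Fin n) (ι' := Sym2 (Fin n))
    (X := fun _ => ℝ)
    (fun i : Fin n ⊕ Sym2 (Fin n) =>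
        gaussianReal 0 (Sum.elim (fun _ => ση ^ 2) (fun _ => σΔ ^ 2) i))
  have h2 := h.measure_preimage ((measurable_view H G X) hO).nullMeasurableSet
  exact h2.symm

theorem gopaOn_le_of_flow {n : ℕ} {H : Finset (Fin n)} {G : SimpleGraph (Fin n)} {v : Fin n}
    (hv : v ∈ H) {y : Sym2 (Fin n) → ℝ} (hy : IsHonestFlow H G v y) {X X' : Dataset n}
    (hX : ∀ u, u ≠ v → X u = X' u) {ση σΔ : ℝ≥0} (hση : 0 < ση) (hσΔ : 0 < σΔ) {θ ε : ℝ}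
    (hθ : 1 / ((H.card : ℝ) * (ση : ℝ) ^ 2) + (∑ e, y e ^ 2) / (σΔ : ℝ) ^ 2 ≤ θ)
    (hε : θ / 2 ≤ ε) {O : Set (View H)} (hO : MeasurableSet O) :
    gopaOn H ση σΔ G X O ≤ ENNReal.ofReal (Real.exp ε) * gopaOn H ση σΔ G X' O +
        ENNReal.ofReal (Real.exp (-((ε - θ / 2) ^ 2 / (2 * θ)))) := by
  set D : ℝ := (X v : ℝ) - X' v with hD
  have hD1 : D ^ 2 ≤ 1 := by
    have h1 := (X v).2
    have h2 := (X' v).2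
    rw [Set.mem_Icc] at h1 h2
    rw [sq_le_one_iff_abs_le_one, abs_le]
    constructor <;> linarith [h1.1, h1.2, h2.1, h2.2]
  have hm : 0 < (H.card : ℝ) := by exact_mod_cast Finset.card_pos.2 ⟨v, hv⟩
  have hση' : 0 < (ση : ℝ) := hση
  have hσΔ' : 0 < (σΔ : ℝ) := hσΔ
  have hθ0 : 0 < θ := lt_of_lt_of_le (by positivity) hθ
  rw [gopaOn_apply H ση σΔ G X hO, gopaOn_apply H ση σΔ G X' hO]
  set t : Fin n ⊕ Sym2 (Fin n) → ℝ :=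
    Sum.elim (fun u => if u ∈ H then D / H.card else 0) (D • y) with ht
  have hS : MeasurableSet {z : Fin n ⊕ Sym2 (Fin n) → ℝ |
      view H G X' (fun u => z (Sum.inl u)) (fun e => z (Sum.inr e)) ∈ O} := by
    have : Measurable fun z : Fin n ⊕ Sym2 (Fin n) → ℝ =>
        ((fun u => z (Sum.inl u), fun e => z (Sum.inr e)) :
          (Fin n → ℝ) × (Sym2 (Fin n) → ℝ)) := by fun_prop
    exact ((measurable_view H G X').comp this) hO
  have hpre : {z : Fin n ⊕ Sym2 (Fin n) → ℝ |
      view H G X (fun u => z (Sum.inl u)) (fun e => z (Sum.inr e)) ∈ O} =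
      (fun z => z + t) ⁻¹' {z : Fin n ⊕ Sym2 (Fin n) → ℝ |
      view H G X' (fun u => z (Sum.inl u)) (fun e => z (Sum.inr e)) ∈ O} := by
    ext z
    exact iff_of_eq (congrArg (· ∈ O) (view_shift hv hy hX _ _))
  rw [hpre]
  refine gaussianPi_shift_le _ ?_ t hθ0 (le_trans ?_ hθ) hε hS
  · rintro (u | e)
    · exact (pow_pos hση 2).ne'
    · exact (pow_pos hσΔ 2).ne'
  · rw [Fintype.sum_sum_type]
    simp only [ht, Sum.elim_inl, Sum.elim_inr, NNReal.coe_pow]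
    refine add_le_add ?_ ?_
    · have h1 : ∀ u, (if u ∈ H then D / (H.card : ℝ) else 0) ^ 2 / (ση : ℝ) ^ 2 =
          if u ∈ H then (D / (H.card : ℝ)) ^ 2 / (ση : ℝ) ^ 2 else 0 := by
        intro u; split_ifs <;> simp
      simp_rw [h1]
      rw [Finset.sum_ite_mem, Finset.univ_inter, Finset.sum_const, nsmul_eq_mul]
      have : (H.card : ℝ) * ((D / H.card) ^ 2 / (ση : ℝ) ^ 2) =
          D ^ 2 / ((H.card : ℝ) * (ση : ℝ) ^ 2) := by field_simp
      rw [this]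
      gcongr
    · rw [← Finset.sum_div]
      refine div_le_div_of_nonneg_right (Finset.sum_le_sum fun e _ => ?_) (by positivity)
      rw [Pi.smul_apply, smul_eq_mul, mul_pow]
      exact mul_le_of_le_one_left (sq_nonneg _) hD1

/-! ### Duality between flows and potentials -/

/-- The Dirichlet energy of `f` on the graph induced on `H`. -/
noncomputable def dirichlet {n : ℕ} (H : Finset (Fin n)) (G : SimpleGraph (Fin n))
    (f : Fin n → ℝ) : ℝ :=
  open Classical in
  ∑ p ∈ (H ×ˢ H).filter fun p => G.Adj p.1 p.2 ∧ f p.2 < f p.1, (f p.1 - f p.2) ^ 2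

open Classical in
/-- The differences of a function along the edges inside `H`. -/
noncomputable def honestGrad {n : ℕ} (H : Finset (Fin n)) (G : SimpleGraph (Fin n)) :
    (Fin n → ℝ) →ₗ[ℝ] EuclideanSpace ℝ (Sym2 (Fin n)) where
  toFun f := WithLp.toLp 2 fun e =>
    if e ∈ G.edgeSet ∧ e.inf ∈ H ∧ e.sup ∈ H then f e.inf - f e.sup else 0
  map_add' f g := by
    ext e
    simp only [PiLp.add_apply, Pi.add_apply]
    split_ifs <;> ring
  map_smul' a f := by
    ext e
    simp only [PiLp.smul_apply, Pi.smul_apply, smul_eq_mul, RingHom.id_apply]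
    split_ifs <;> ring

theorem honestGrad_mk_of_lt {n : ℕ} {H : Finset (Fin n)} {G : SimpleGraph (Fin n)}
    (f : Fin n → ℝ) {u w : Fin n} (hG : G.Adj u w) (hu : u ∈ H) (hw : w ∈ H) (h : u < w) :
    honestGrad H G f s(u, w) = f u - f w := by
  simp [honestGrad, hG, h.le, hu, hw]

theorem honestGrad_mk_of_gt {n : ℕ} {H : Finset (Fin n)} {G : SimpleGraph (Fin n)}
    (f : Fin n → ℝ) {u w : Fin n} (hG : G.Adj u w) (hu : u ∈ H) (hw : w ∈ H) (h : w < u) :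
    honestGrad H G f s(u, w) = f w - f u := by
  rw [Sym2.eq_swap]
  exact honestGrad_mk_of_lt f hG.symm hw hu h

theorem honestGrad_mk_of_not {n : ℕ} {H : Finset (Fin n)} {G : SimpleGraph (Fin n)}
    (f : Fin n → ℝ) {u w : Fin n} (h : ¬ (G.Adj u w ∧ u ∈ H ∧ w ∈ H)) :
    honestGrad H G f s(u, w) = 0 := by
  simp only [honestGrad, LinearMap.coe_mk, AddHom.coe_mk]
  refine if_neg ?_
  rintro ⟨h1, h2, h3⟩
  rw [Sym2.inf_mk] at h2
  rw [Sym2.sup_mk] at h3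
  rw [SimpleGraph.mem_edgeSet] at h1
  rcases le_total u w with huw | huw
  · rw [inf_of_le_left huw] at h2
    rw [sup_of_le_right huw] at h3
    exact h ⟨h1, h2, h3⟩
  · rw [inf_of_le_right huw] at h2
    rw [sup_of_le_left huw] at h3
    exact h ⟨h1, h3, h2⟩

theorem dirichlet_le_norm_honestGrad_sq {n : ℕ} (H : Finset (Fin n)) (G : SimpleGraph (Fin n))
    (f : Fin n → ℝ) : dirichlet H G f ≤ ‖honestGrad H G f‖ ^ 2 := by
  classical
  rw [EuclideanSpace.real_norm_sq_eq, dirichlet]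
  set T := (H ×ˢ H).filter fun p => G.Adj p.1 p.2 ∧ f p.2 < f p.1 with hT
  -- Each unordered edge occurs once, since `T` contains only its downhill orientation.
  have hinj : Set.InjOn (fun p : Fin n × Fin n => s(p.1, p.2)) T := by
    rintro ⟨a, b⟩ hab ⟨c, d⟩ hcd h
    simp only [hT, Finset.coe_filter, Set.mem_ofPred_eq] at hab hcd
    rcases Sym2.eq_iff.1 h with ⟨h1, h2⟩ | ⟨h1, h2⟩
    · simp_all
    · simp only at h1 h2
      subst h1 h2
      exact absurd hab.2.2 (not_lt.2 hcd.2.2.le)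
  calc ∑ p ∈ T, (f p.1 - f p.2) ^ 2 = ∑ p ∈ T, (honestGrad H G f s(p.1, p.2)) ^ 2 := by
        refine Finset.sum_congr rfl fun p hp => ?_
        simp only [hT, Finset.mem_filter, Finset.mem_product] at hp
        rcases lt_trichotomy p.1 p.2 with h | h | h
        · rw [honestGrad_mk_of_lt f hp.2.1 hp.1.1 hp.1.2 h]
        · exact absurd h hp.2.1.ne
        · rw [honestGrad_mk_of_gt f hp.2.1 hp.1.1 hp.1.2 h]
          ring
    _ = ∑ e ∈ T.image fun p => s(p.1, p.2), (honestGrad H G f e) ^ 2 := by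
        rw [Finset.sum_image hinj]
    _ ≤ _ := Finset.sum_le_univ_sum_of_nonneg fun e => sq_nonneg _

/-- Divergence is the adjoint of the gradient, tested here on an indicator function. -/
theorem sum_mul_honestGrad_single {n : ℕ} {H : Finset (Fin n)} (G : SimpleGraph (Fin n))
    {y : Sym2 (Fin n) → ℝ} (hy : ∀ u ∉ H, ∀ w, y s(u, w) = 0) {u : Fin n} (hu : u ∈ H) :
    ∑ e, y e * honestGrad H G (Pi.single u 1) e = ∑ w, pairNoise G y u w := by
  symm
  refine Fintype.sum_of_injective (fun w => s(u, w)) (fun a b h => Sym2.congr_right.1 h) _ _ ?_ ?_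
  · intro e he
    induction e with | _ a b
    have ha : a ≠ u := fun h => he ⟨b, by simp [h]⟩
    have hb : b ≠ u := fun h => he ⟨a, by simp [h, Sym2.eq_swap]⟩
    by_cases hG : G.Adj a b ∧ a ∈ H ∧ b ∈ H
    · rcases lt_trichotomy a b with h | h | h
      · rw [honestGrad_mk_of_lt _ hG.1 hG.2.1 hG.2.2 h]
        simp [ha, hb]
      · exact absurd h hG.1.ne
      · rw [honestGrad_mk_of_gt _ hG.1 hG.2.1 hG.2.2 h]
        simp [ha, hb]
    · rw [honestGrad_mk_of_not _ hG, mul_zero]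
  · intro w
    unfold pairNoise
    by_cases hw : w ∈ H
    · by_cases hG : G.Adj u w
      · rw [if_pos hG]
        have hne := hG.ne'
        split_ifs with h
        · rw [honestGrad_mk_of_lt _ hG hu hw h]
          simp [hne]
        · rw [honestGrad_mk_of_gt _ hG hu hw (lt_of_le_of_ne (not_lt.1 h) hne)]
          simp [hne]
      · rw [if_neg hG, honestGrad_mk_of_not _ fun h => hG h.1, mul_zero]
    · have := hy w hw u
      rw [Sym2.eq_swap] at this
      simp [this]

/-- The hypothesis says that the functional `f ↦ f v - mean f` is bounded by `√R` times the norm of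
the gradient. It therefore factors through the range of the gradient, and its Riesz representative
there is the required flow. -/
theorem exists_honestFlow {n : ℕ} {H : Finset (Fin n)} {G : SimpleGraph (Fin n)} {v : Fin n}
    {R : ℝ} (hR : 0 ≤ R)
    (h : ∀ f : Fin n → ℝ, (f v - (∑ u ∈ H, f u) / H.card) ^ 2 ≤ R * dirichlet H G f) :
    ∃ y, IsHonestFlow H G v y ∧ ∑ e, y e ^ 2 ≤ R := by
  classical
  set l : (Fin n → ℝ) →ₗ[ℝ] ℝ :=
    LinearMap.proj v - (1 / (H.card : ℝ)) • ∑ u ∈ H, LinearMap.proj u with hl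
  have hlf : ∀ f, l f = f v - (∑ u ∈ H, f u) / H.card := by
    intro f
    simp [hl, LinearMap.sum_apply]
    ring
  set D := honestGrad H G with hD
  have hbound : ∀ f, (l f) ^ 2 ≤ R * ‖D f‖ ^ 2 := fun f => by
    rw [hlf]
    exact (h f).trans (mul_le_mul_of_nonneg_left (dirichlet_le_norm_honestGrad_sq H G f) hR)
  obtain ⟨s, hs⟩ := D.rangeRestrict.exists_rightInverse_of_surjective D.range_rangeRestrict
  have hs' : ∀ p : D.range, D (s p) = p := fun p => by
    have := LinearMap.congr_fun hs p
    simpa using congrArg Subtype.val this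
  have hle : ∀ p : D.range, ‖(l ∘ₗ s) p‖ ≤ Real.sqrt R * ‖p‖ := fun p => by
    rw [Real.norm_eq_abs, LinearMap.comp_apply]
    refine abs_le_of_sq_le_sq ?_ (by positivity)
    rw [mul_pow, Real.sq_sqrt hR]
    have := hbound (s p)
    rwa [hs'] at this
  set g : StrongDual ℝ D.range := (l ∘ₗ s).mkContinuous (Real.sqrt R) hle with hg
  set z : D.range := (InnerProductSpace.toDual ℝ D.range).symm g with hz
  have hzn : ‖z‖ ≤ Real.sqrt R := by
    rw [hz, LinearIsometryEquiv.norm_map]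
    exact LinearMap.mkContinuous_norm_le _ (Real.sqrt_nonneg _) _
  have hzi : ∀ f, inner ℝ (z : EuclideanSpace ℝ (Sym2 (Fin n))) (D f) = l f := fun f => by
    have h1 : inner ℝ z (D.rangeRestrict f) = g (D.rangeRestrict f) := by
      rw [hz, InnerProductSpace.toDual_symm_apply]
    have h2 : g (D.rangeRestrict f) = l (s (D.rangeRestrict f)) := rfl
    -- The bound forces `l` to vanish on the kernel of `D`, so the choice of preimage is irrelevant.
    have h3 : l (s (D.rangeRestrict f)) = l f := by
      have h4 := hbound (s (D.rangeRestrict f) - f)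
      rw [map_sub D, hs', show ((D.rangeRestrict f : D.range) : EuclideanSpace ℝ (Sym2 (Fin n))) = D f from rfl,
        sub_self, norm_zero] at h4
      have h5 : l (s (D.rangeRestrict f) - f) = 0 := by
        have : l (s (D.rangeRestrict f) - f) ^ 2 = 0 := le_antisymm (by simpa using h4) (sq_nonneg _)
        exact pow_eq_zero_iff two_ne_zero |>.1 this
      rw [map_sub, sub_eq_zero] at h5
      exact h5
    rw [← h3, ← h2, ← h1]
    rfl
  -- The representative is itself a gradient, hence zero off the honest edges.
  have hsupp : ∀ u ∉ H, ∀ w, (z : EuclideanSpace ℝ (Sym2 (Fin n))) s(u, w) = 0 := by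
    intro u hu w
    rw [← hs' z]
    exact honestGrad_mk_of_not _ fun h => hu h.2.1
  refine ⟨fun e => (z : EuclideanSpace ℝ (Sym2 (Fin n))) e, ⟨hsupp, fun u hu => ?_⟩, ?_⟩
  · rw [← sum_mul_honestGrad_single G hsupp hu]
    have h1 := hzi (Pi.single u 1)
    rw [hlf, PiLp.inner_apply] at h1
    simp only [RCLike.inner_apply, conj_trivial] at h1
    rw [Finset.sum_congr rfl fun e _ => mul_comm _ _, h1]
    congr 1
    · simp only [Pi.single_apply, eq_comm]
    · rw [Finset.sum_eq_single u (fun b _ hb => by simp [hb]) (fun h => absurd hu h)]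
      simp
  · have h1 : ‖(z : EuclideanSpace ℝ (Sym2 (Fin n)))‖ ^ 2 ≤ Real.sqrt R ^ 2 :=
      pow_le_pow_left₀ (norm_nonneg _) hzn 2
    rwa [EuclideanSpace.real_norm_sq_eq, Real.sq_sqrt hR] at h1

/-! ### Potentials on an expanding graph -/

theorem dirichlet_neg {n : ℕ} (H : Finset (Fin n)) (G : SimpleGraph (Fin n)) (f : Fin n → ℝ) :
    dirichlet H G (-f) = dirichlet H G f := by
  classical
  unfold dirichlet
  refine Finset.sum_bij (fun p _ => p.swap) ?_ ?_ ?_ ?_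
  · rintro ⟨a, b⟩ h
    simp only [Finset.mem_filter, Finset.mem_product, Pi.neg_apply, neg_lt_neg_iff,
      Prod.swap_prod_mk] at h ⊢
    exact ⟨h.1.symm, h.2.1.symm, h.2.2⟩
  · rintro ⟨a, b⟩ _ ⟨c, d⟩ _ h
    simpa [and_comm] using h
  · rintro ⟨a, b⟩ h
    refine ⟨(b, a), ?_, rfl⟩
    simp only [Finset.mem_filter, Finset.mem_product, Pi.neg_apply, neg_lt_neg_iff] at h ⊢
    exact ⟨h.1.symm, h.2.1.symm, h.2.2⟩
  · rintro ⟨a, b⟩ _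
    simp only [Pi.neg_apply, Prod.swap_prod_mk]
    ring

/-- Take the largest value of `f` that at least `j` points reach. With ties neither count need equal
`j`, hence the two inequalities. -/
theorem exists_quantile {V : Type*} (H : Finset V) (f : V → ℝ) (j : ℕ) (h1 : 1 ≤ j)
    (hj : j ≤ H.card) :
    ∃ q, j ≤ (H.filter fun x => q ≤ f x).card ∧ (H.filter fun x => q < f x).card < j := by
  classical
  set C := (H.image f).filter fun q => j ≤ (H.filter fun x => q ≤ f x).card with hC
  have hH : H.Nonempty := Finset.card_pos.1 (by omega)
  have hCne : C.Nonempty := by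
    obtain ⟨x, hx, hmin⟩ := H.exists_min_image f hH
    refine ⟨f x, Finset.mem_filter.2 ⟨Finset.mem_image_of_mem f hx, ?_⟩⟩
    rwa [Finset.filter_true_of_mem hmin]
  obtain ⟨q, hq, hmax⟩ := C.exists_max_image id hCne
  refine ⟨q, (Finset.mem_filter.1 hq).2, ?_⟩
  by_contra! hlt
  obtain ⟨x, hx, hmin⟩ := (H.filter fun x => q < f x).exists_min_image f
    (Finset.card_pos.1 (by omega))
  have hx' := Finset.mem_filter.1 hx
  have hmem : f x ∈ C := by
    refine Finset.mem_filter.2 ⟨Finset.mem_image_of_mem f hx'.1, hlt.trans ?_⟩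
    refine Finset.card_le_card fun y hy => ?_
    exact Finset.mem_filter.2 ⟨(Finset.mem_filter.1 hy).1, hmin y hy⟩
  exact absurd (hmax _ hmem) (not_le.2 hx'.2)

/-- Clipping to `[b, a]` is monotone and fixes the endpoints of every interval that is counted, so
the sum is dominated by a telescoping one. -/
theorem sum_chain_le {T : ℕ → ℝ} (hT : Antitone T) (N : ℕ) (a b : ℝ) :
    ∑ i ∈ Finset.range N, (if T i ≤ a ∧ b ≤ T (i + 1) then T i - T (i + 1) else 0) ≤
      max b (min a (T 0)) - max b (min a (T N)) := by
  induction N with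
  | zero => simp
  | succ N ih =>
    rw [Finset.sum_range_succ]
    have h := hT (Nat.le_succ N)
    have : (if T N ≤ a ∧ b ≤ T (N + 1) then T N - T (N + 1) else 0) ≤
        max b (min a (T N)) - max b (min a (T (N + 1))) := by
      split_ifs with hc
      · rw [min_eq_right hc.1, min_eq_right (h.trans hc.1), max_eq_right hc.2,
          max_eq_right (hc.2.trans h)]
      · exact sub_nonneg.2 (max_le_max le_rfl (min_le_min le_rfl h))
    linarith

theorem sum_chain_le' {r : ℕ → ℝ} (hr : Monotone r) (N : ℕ) (a b : ℝ) :
    ∑ i ∈ Finset.range N, (if r (i + 1) ≤ a ∧ b ≤ r i then r (i + 1) - r i else 0) ≤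
      max b (min a (r N)) - max b (min a (r 0)) := by
  induction N with
  | zero => simp
  | succ N ih =>
    rw [Finset.sum_range_succ]
    have h := hr (Nat.le_succ N)
    have : (if r (N + 1) ≤ a ∧ b ≤ r N then r (N + 1) - r N else 0) ≤
        max b (min a (r (N + 1))) - max b (min a (r N)) := by
      split_ifs with hc
      · rw [min_eq_right hc.1, min_eq_right (h.trans hc.1), max_eq_right hc.2,
          max_eq_right (hc.2.trans h)]
      · exact sub_nonneg.2 (max_le_max le_rfl (min_le_min le_rfl h))
    linarith

open Classical in
/-- The edges inside `H` across which `f` drops from at least `s` to at most `t`. -/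
noncomputable def crossing {n : ℕ} (H : Finset (Fin n)) (G : SimpleGraph (Fin n))
    (f : Fin n → ℝ) (s t : ℝ) : Finset (Fin n × Fin n) :=
  (H ×ˢ H).filter fun p => G.Adj p.1 p.2 ∧ s ≤ f p.1 ∧ f p.2 ≤ t

/-- Both chains end at the same level, so the gaps spanned by one edge are disjoint subintervals of
its drop. Their squared lengths then sum to at most the square of the drop; summing over edges
counts each gap once per crossing edge. -/
theorem sum_crossing_le_dirichlet {n : ℕ} (H : Finset (Fin n)) (G : SimpleGraph (Fin n))
    (f : Fin n → ℝ) {T r : ℕ → ℝ} (hT : Antitone T) (hr : Monotone r) {N N' : ℕ}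
    (hTr : T N = r N') {e e' : ℕ → ℝ}
    (he : ∀ i < N, T (i + 1) < T i → e i ≤ (crossing H G f (T i) (T (i + 1))).card)
    (he' : ∀ i < N', r i < r (i + 1) → e' i ≤ (crossing H G f (r (i + 1)) (r i)).card) :
    ∑ i ∈ Finset.range N, e i * (T i - T (i + 1)) ^ 2 +
      ∑ i ∈ Finset.range N', e' i * (r (i + 1) - r i) ^ 2 ≤ dirichlet H G f := by
  classical
  set P := (H ×ˢ H).filter fun p => G.Adj p.1 p.2 ∧ f p.2 < f p.1 with hP
  have key : ∀ s t x : ℝ, (t < s → x ≤ (crossing H G f s t).card) → t ≤ s →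
      x * (s - t) ^ 2 ≤ ∑ p ∈ P, (if s ≤ f p.1 ∧ f p.2 ≤ t then s - t else 0) ^ 2 := by
    intro s t x hx hts
    rcases hts.eq_or_lt with h | h
    · subst h
      simp
    · calc x * (s - t) ^ 2 ≤ (crossing H G f s t).card * (s - t) ^ 2 := by
            gcongr
            exact hx h
        _ = ∑ p ∈ crossing H G f s t, (if s ≤ f p.1 ∧ f p.2 ≤ t then s - t else 0) ^ 2 := by
            rw [← nsmul_eq_mul, ← Finset.sum_const]
            refine Finset.sum_congr rfl fun p hp => ?_
            rw [if_pos (Finset.mem_filter.1 hp).2.2]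
        _ ≤ _ := by
            refine Finset.sum_le_sum_of_subset_of_nonneg (fun p hp => ?_) fun _ _ _ => sq_nonneg _
            have hp' := Finset.mem_filter.1 hp
            exact Finset.mem_filter.2 ⟨hp'.1, hp'.2.1, by linarith [hp'.2.2.1, hp'.2.2.2]⟩
  calc _ ≤ ∑ i ∈ Finset.range N, ∑ p ∈ P,
          (if T i ≤ f p.1 ∧ f p.2 ≤ T (i + 1) then T i - T (i + 1) else 0) ^ 2 +
        ∑ i ∈ Finset.range N', ∑ p ∈ P,
          (if r (i + 1) ≤ f p.1 ∧ f p.2 ≤ r i then r (i + 1) - r i else 0) ^ 2 := by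
        refine add_le_add (Finset.sum_le_sum fun i hi => ?_) (Finset.sum_le_sum fun i hi => ?_)
        · exact key _ _ _ (he i (Finset.mem_range.1 hi)) (hT (Nat.le_succ i))
        · exact key _ _ _ (he' i (Finset.mem_range.1 hi)) (hr (Nat.le_succ i))
    _ = ∑ p ∈ P, (∑ i ∈ Finset.range N,
          (if T i ≤ f p.1 ∧ f p.2 ≤ T (i + 1) then T i - T (i + 1) else 0) ^ 2 +
        ∑ i ∈ Finset.range N',
          (if r (i + 1) ≤ f p.1 ∧ f p.2 ≤ r i then r (i + 1) - r i else 0) ^ 2) := by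
        rw [Finset.sum_add_distrib, Finset.sum_comm, Finset.sum_comm (s := Finset.range N')]
    _ ≤ _ := by
        refine Finset.sum_le_sum fun p hp => ?_
        have hp' := (Finset.mem_filter.1 hp).2.2
        have n1 : ∀ i ∈ Finset.range N,
            0 ≤ (if T i ≤ f p.1 ∧ f p.2 ≤ T (i + 1) then T i - T (i + 1) else 0) := by
          intro i _
          split_ifs
          · exact sub_nonneg.2 (hT (Nat.le_succ i))
          · exact le_rfl
        have n2 : ∀ i ∈ Finset.range N',
            0 ≤ (if r (i + 1) ≤ f p.1 ∧ f p.2 ≤ r i then r (i + 1) - r i else 0) := by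
          intro i _
          split_ifs
          · exact sub_nonneg.2 (hr (Nat.le_succ i))
          · exact le_rfl
        have s1 := Finset.sum_sq_le_sq_sum_of_nonneg n1
        have s2 := Finset.sum_sq_le_sq_sum_of_nonneg n2
        have t1 := sum_chain_le hT N (f p.1) (f p.2)
        have t2 := sum_chain_le' hr N' (f p.1) (f p.2)
        rw [hTr] at t1
        have u1 : max (f p.2) (min (f p.1) (T 0)) ≤ f p.1 := max_le hp'.le (min_le_left _ _)
        have u2 : f p.2 ≤ max (f p.2) (min (f p.1) (r 0)) := le_max_left _ _
        have z1 := Finset.sum_nonneg n1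
        have z2 := Finset.sum_nonneg n2
        nlinarith

/-- Telescope `max (r i) x`: only the steps ending above `x` contribute. -/
theorem le_sum_drops {r : ℕ → ℝ} (hr : Monotone r) (N : ℕ) {x : ℝ} (hx : r 0 ≤ x) :
    r N - x ≤ ∑ i ∈ Finset.range N, if x < r (i + 1) then r (i + 1) - r i else 0 := by
  have : max (r N) x - max (r 0) x ≤
      ∑ i ∈ Finset.range N, if x < r (i + 1) then r (i + 1) - r i else 0 := by
    rw [← Finset.sum_range_sub (fun i => max (r i) x)]
    refine Finset.sum_le_sum fun i _ => ?_
    have h := hr (Nat.le_succ i)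
    split_ifs with hc
    · rw [max_eq_left hc.le]
      linarith [le_max_left (r i) x]
    · rw [max_eq_right (not_lt.1 hc), max_eq_right (h.trans (not_lt.1 hc)), sub_self]
  rw [max_eq_right hx] at this
  linarith [le_max_left (r N) x]

/-- Cauchy–Schwarz in its linearised form: `l = a / R` gives the claim. This lets separate sums be
estimated with a common `l` and then added. -/
theorem sq_le_of_sums {a R E : ℝ} (ha : 0 ≤ a) (hR : 0 < R)
    (h : ∀ l : ℝ, 0 < l → 2 * a ≤ l * R + E / l) : a ^ 2 ≤ R * E := by
  have hE : 0 ≤ E := by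
    by_contra! hE
    have h1 := h (Real.sqrt (-E / R)) (Real.sqrt_pos.2 (div_pos (by linarith) hR))
    set l := Real.sqrt (-E / R) with hl
    have hlp : 0 < l := Real.sqrt_pos.2 (div_pos (by linarith) hR)
    have hl2 : l ^ 2 = -E / R := Real.sq_sqrt (div_nonneg (by linarith) hR.le)
    have h2 : E = -(l ^ 2 * R) := by rw [hl2]; field_simp
    have h3 := h (l / 2) (by linarith)
    rw [h2] at h3
    have h4 : l / 2 * R + -(l ^ 2 * R) / (l / 2) = -(3 / 2 * (l * R)) := by field_simp; ring
    rw [h4] at h3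
    nlinarith [mul_pos hlp hR]
  rcases ha.eq_or_lt with h0 | h0
  · rw [← h0]
    simpa using mul_nonneg hR.le hE
  · have h1 := h (a / R) (div_pos h0 hR)
    have h2 : a / R * R + E / (a / R) = a + E * R / a := by field_simp
    rw [h2] at h1
    have h3 : a ≤ E * R / a := by linarith
    rw [le_div_iff₀ h0] at h3
    nlinarith

open Classical in
/-- The graph expands inside `H`: a set `A` sends many edges out of every set `Q ⊇ A` that is less
than twice as large. -/
def Expands {n : ℕ} (H : Finset (Fin n)) (G : SimpleGraph (Fin n)) (c : ℝ) : Prop :=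
  ∀ A Q : Finset (Fin n), A ⊆ Q → Q ⊆ H → A.Nonempty → Q.card < 2 * A.card →
    2 * Q.card ≤ H.card → c * A.card * (H.card - Q.card) / H.card ≤
      ((A ×ˢ (H \ Q)).filter fun p => G.Adj p.1 p.2).card

theorem quantile_anti {V : Type*} (H : Finset V) (f : V → ℝ) {q : ℕ → ℝ}
    (hq : ∀ j, 1 ≤ j → j ≤ H.card →
      j ≤ (H.filter fun x => q j ≤ f x).card ∧ (H.filter fun x => q j < f x).card < j)
    {i j : ℕ} (hi : 1 ≤ i) (hij : i ≤ j) (hj : j ≤ H.card) : q j ≤ q i := by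
  by_contra! h
  have h1 := (hq i hi (hij.trans hj)).2
  have h2 := (hq j (hi.trans hij) hj).1
  have h3 : (H.filter fun x => q j ≤ f x).card ≤ (H.filter fun x => q i < f x).card :=
    Finset.card_le_card fun x hx => by
      have := Finset.mem_filter.1 hx
      exact Finset.mem_filter.2 ⟨this.1, h.trans_le this.2⟩
  omega

/-- Apply expansion to exactly `a` points of `{f ≥ s}` and to `Q = {f > t}`: an edge from the former
to the complement of the latter crosses the gap. -/
theorem Expands.card_crossing_ge {n : ℕ} {H : Finset (Fin n)} {G : SimpleGraph (Fin n)} {c : ℝ}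
    (hG : Expands H G c) {f : Fin n → ℝ} {s t : ℝ} {a : ℕ} (hts : t < s) (ha : 1 ≤ a)
    (hs : a ≤ (H.filter fun x => s ≤ f x).card)
    (ht : (H.filter fun x => t < f x).card < 2 * a)
    (ht2 : 2 * (H.filter fun x => t < f x).card ≤ H.card) :
    c * a * (H.card - (H.filter fun x => t < f x).card) / H.card ≤
      (crossing H G f s t).card := by
  classical
  obtain ⟨A, hA, hAc⟩ := Finset.exists_subset_card_eq hs
  have hAQ : A ⊆ H.filter fun x => t < f x := fun x hx => by
    have := Finset.mem_filter.1 (hA hx)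
    exact Finset.mem_filter.2 ⟨this.1, hts.trans_le this.2⟩
  have h := hG A (H.filter fun x => t < f x) hAQ (Finset.filter_subset _ _)
    (Finset.card_pos.1 (by omega)) (by omega) ht2
  rw [hAc] at h
  refine h.trans (Nat.cast_le.2 (Finset.card_le_card fun p hp => ?_))
  simp only [Finset.mem_filter, Finset.mem_product, Finset.mem_sdiff, not_and, not_lt] at hp
  have h1 := Finset.mem_filter.1 (hA hp.1.1)
  exact Finset.mem_filter.2 ⟨Finset.mem_product.2 ⟨h1.1, hp.1.2.1⟩, hp.2, h1.2,
    hp.1.2.2 hp.1.2.1⟩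

theorem card_crossing_neg {n : ℕ} (H : Finset (Fin n)) (G : SimpleGraph (Fin n))
    (f : Fin n → ℝ) (s t : ℝ) :
    (crossing H G (-f) (-t) (-s)).card = (crossing H G f s t).card := by
  classical
  unfold crossing
  refine Finset.card_bij (fun p _ => p.swap) ?_ ?_ ?_
  · rintro ⟨a, b⟩ h
    simp only [Finset.mem_filter, Finset.mem_product, Pi.neg_apply, neg_le_neg_iff,
      Prod.swap_prod_mk] at h ⊢
    exact ⟨h.1.symm, h.2.1.symm, h.2.2.2, h.2.2.1⟩
  · rintro ⟨a, b⟩ _ ⟨c, d⟩ _ h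
    simpa [and_comm] using h
  · rintro ⟨a, b⟩ h
    refine ⟨(b, a), ?_, rfl⟩
    simp only [Finset.mem_filter, Finset.mem_product, Pi.neg_apply, neg_le_neg_iff] at h ⊢
    exact ⟨h.1.symm, h.2.1.symm, h.2.2.2, h.2.2.1⟩

/-- Apart from `v` itself, fewer than `J - 1` points lie above `t`; all other honest neighbours of
`v` are across the gap. -/
theorem card_crossing_ge_degree {n : ℕ} {H : Finset (Fin n)} {G : SimpleGraph (Fin n)}
    {v : Fin n} (hv : v ∈ H) {d : ℝ}
    (hdeg : open Classical in d ≤ (H.filter fun w => G.Adj v w).card) {f : Fin n → ℝ} {t : ℝ}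
    {J : ℕ} (hts : t < f v) (ht : (H.filter fun x => t < f x).card < J) :
    d + 1 - J ≤ (crossing H G f (f v) t).card := by
  classical
  have h1 : (H.filter fun w => G.Adj v w).card ≤
      (crossing H G f (f v) t).card + ((H.filter fun x => t < f x).erase v).card := by
    calc (H.filter fun w => G.Adj v w).card
        ≤ ((crossing H G f (f v) t).image Prod.snd ∪
            (H.filter fun x => t < f x).erase v).card := by
          refine Finset.card_le_card fun w hw => ?_
          have hw' := Finset.mem_filter.1 hw
          rcases le_or_gt (f w) t with h | h
          · refine Finset.mem_union_left _ (Finset.mem_image.2 ⟨(v, w), ?_, rfl⟩)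
            exact Finset.mem_filter.2 ⟨Finset.mem_product.2 ⟨hv, hw'.1⟩, hw'.2, le_rfl, h⟩
          · refine Finset.mem_union_right _ (Finset.mem_erase.2 ⟨hw'.2.ne', ?_⟩)
            exact Finset.mem_filter.2 ⟨hw'.1, h⟩
      _ ≤ _ := (Finset.card_union_le _ _).trans (Nat.add_le_add_right Finset.card_image_le _)
  rw [Finset.card_erase_of_mem (Finset.mem_filter.2 ⟨hv, hts⟩)] at h1
  have h2 : (H.filter fun w => G.Adj v w).card + 2 ≤ (crossing H G f (f v) t).card + J := by
    have : (H.filter fun x => t < f x).Nonempty := ⟨v, Finset.mem_filter.2 ⟨hv, hts⟩⟩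
    have := this.card_pos
    omega
  have h3 : ((H.filter fun w => G.Adj v w).card : ℝ) + 2 ≤
      (crossing H G f (f v) t).card + J := by exact_mod_cast h2
  linarith

theorem two_mul_le_div_add {e D w l : ℝ} (he : 0 < e) (hl : 0 < l) :
    2 * (w * D) ≤ l * (w ^ 2 / e) + e * D ^ 2 / l := by
  have h : l * (w ^ 2 / e) + e * D ^ 2 / l - 2 * (w * D) = (l * w - e * D) ^ 2 / (e * l) := by
    field_simp
    ring
  have : 0 ≤ (l * w - e * D) ^ 2 / (e * l) := by positivity
  linarith

theorem sum_inv_two_pow_le (N : ℕ) : ∑ i ∈ Finset.range N, (1 / 2 ^ i : ℝ) ≤ 2 := by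
  have h := sum_geometric_two_le N
  simpa using h

theorem sum_two_pow_le (N : ℕ) : ∑ i ∈ Finset.range N, (2 ^ i : ℝ) ≤ 2 ^ N := by
  rw [geom_sum_eq (by norm_num)]
  norm_num

/-- The three summands of the constant come from three ranges of `f`: the drop from `f v` to the
`J`-th largest value, controlled by the degree of `v`; the drop to the median along ranks `2 ^ i *
J`; and the part below the median, where a gap seen by about `2 ^ i` points enters the mean only
with weight about `2 ^ i / m`. -/
theorem Expands.potential_bound_of_nonneg {n : ℕ} {H : Finset (Fin n)} {G : SimpleGraph (Fin n)}
    {c : ℝ} (hc : 0 < c) (hG : Expands H G c) {v : Fin n} (hv : v ∈ H) {d : ℝ} {J : ℕ}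
    (hJ : 2 ≤ J) (hJd : J < d + 1)
    (hdeg : open Classical in d ≤ (H.filter fun w => G.Adj v w).card) (f : Fin n → ℝ)
    (hf : 0 ≤ f v - (∑ u ∈ H, f u) / H.card) :
    (f v - (∑ u ∈ H, f u) / H.card) ^ 2 ≤
      (1 / (d + 1 - J) + (2 / J + 4 * (Nat.log 2 H.card : ℝ) / H.card) / c + 8 / (c * H.card)) *
        dirichlet H G f := by
  set m := H.card with hm
  have hm1 : 1 ≤ m := Finset.card_pos.2 ⟨v, hv⟩
  have hmR : (0 : ℝ) < m := by exact_mod_cast hm1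
  set N := Nat.log 2 m with hN
  have hN1 : 2 ^ N ≤ m := Nat.pow_log_le_self 2 (by omega)
  have hN2 : m < 2 ^ N * 2 := by
    have := Nat.lt_pow_succ_log_self (b := 2) (by norm_num) m
    rwa [pow_succ] at this
  -- Rank `h` from the top is rank `h'` from the bottom, so both chains meet at the same quantile.
  -- Fewer than `h` points lie strictly above it and fewer than `h'` strictly below, hence at most
  -- half on either side, as expansion demands.
  obtain ⟨h', hh'⟩ : ∃ h', h' = (m + 1) / 2 := ⟨_, rfl⟩
  obtain ⟨h, hh⟩ : ∃ h, h = m + 1 - h' := ⟨_, rfl⟩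
  have hex : ∀ j, ∃ q, 1 ≤ j → j ≤ H.card →
      j ≤ (H.filter fun x => q ≤ f x).card ∧ (H.filter fun x => q < f x).card < j := by
    intro j
    by_cases hj : 1 ≤ j ∧ j ≤ H.card
    · obtain ⟨q, hq⟩ := exists_quantile H f j hj.1 hj.2
      exact ⟨q, fun _ _ => hq⟩
    · exact ⟨0, fun h1 h2 => absurd ⟨h1, h2⟩ hj⟩
  choose q hq using hex
  have hanti : ∀ {i j}, 1 ≤ i → i ≤ j → j ≤ m → q j ≤ q i := fun hi hij hj =>
    quantile_anti H f hq hi hij hj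
  -- the upper thresholds
  set a : ℕ → ℕ := fun i => min (2 ^ i * J) h with ha
  have ha1 : ∀ i, 1 ≤ a i := fun i => le_min (Nat.one_le_iff_ne_zero.2 (by positivity)) (by omega)
  have ham : ∀ i, a i ≤ m := fun i => (min_le_right _ _).trans (by omega)
  have hamono : Monotone a := fun i j hij =>
    min_le_min (Nat.mul_le_mul_right _ (Nat.pow_le_pow_right (by norm_num) hij)) le_rfl
  -- Values are capped at `f v`, since `v` need not be near the top and only the drop below `f v`
  -- counts.
  set T : ℕ → ℝ := fun i => i.casesOn (f v) fun i => min (q (a i)) (f v) with hT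
  have hT0 : T 0 = f v := rfl
  have hTs : ∀ i, T (i + 1) = min (q (a i)) (f v) := fun i => rfl
  have hTanti : Antitone T := by
    refine antitone_nat_of_succ_le fun i => ?_
    cases i with
    | zero => exact min_le_right _ _
    | succ i =>
      exact min_le_min (hanti (ha1 i) (hamono (Nat.le_succ i)) (ham _)) le_rfl
  have haN : a N = h := by
    refine min_eq_right ?_
    calc h ≤ 2 ^ N * 2 := by omega
      _ ≤ 2 ^ N * J := Nat.mul_le_mul_left _ hJ
  -- the lower thresholds
  set b : ℕ → ℕ := fun i => m + 1 - min (2 ^ i) h' with hb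
  have hb1 : ∀ i, 1 ≤ b i := fun i => by
    have : min (2 ^ i) h' ≤ h' := min_le_right _ _
    simp only [hb]; omega
  have hbm : ∀ i, b i ≤ m := fun i => by
    have : 1 ≤ min (2 ^ i) h' := le_min Nat.one_le_two_pow (by omega)
    simp only [hb]; omega
  have hbanti : Antitone b := fun i j hij => by
    have : min (2 ^ i) h' ≤ min (2 ^ j) h' :=
      min_le_min (Nat.pow_le_pow_right (by norm_num) hij) le_rfl
    simp only [hb]; omega
  set r : ℕ → ℝ := fun i => min (q (b i)) (f v) with hr
  have hrmono : Monotone r := fun i j hij =>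
    min_le_min (hanti (hb1 j) (hbanti hij) (hbm i)) le_rfl
  have hbN : b N = h := by
    have : min (2 ^ N) h' = h' := min_eq_right (by omega)
    simp only [hb, this, hh]
  have hTr : T (N + 1) = r N := by
    change min (q (a N)) (f v) = min (q (b N)) (f v)
    rw [haN, hbN]
  -- edge counts
  set e : ℕ → ℝ := fun i => i.casesOn (d + 1 - J) fun i => c / (1 / (2 ^ i * J) + 4 / m) with he
  have hJR : (0 : ℝ) < J := by exact_mod_cast (by omega : 0 < J)
  have he0 : ∀ i, 0 < e i := by
    intro i
    cases i with
    | zero =>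
      change 0 < d + 1 - J
      linarith
    | succ i => simp only [he]; positivity
  have hecount : ∀ i < N + 1, T (i + 1) < T i →
      e i ≤ (crossing H G f (T i) (T (i + 1))).card := by
    intro i _ hlt
    cases i with
    | zero =>
      rw [hTs, hT0] at hlt ⊢
      have hq0 : q (a 0) < f v := by
        by_contra! hcon
        rw [min_eq_right hcon] at hlt
        exact lt_irrefl _ hlt
      rw [min_eq_left hq0.le]
      refine card_crossing_ge_degree hv hdeg hq0 ((hq _ (ha1 0) (ham 0)).2.trans_le ?_)
      exact (min_le_left _ _).trans (by simp)
    | succ i =>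
      rw [hTs, hTs] at hlt ⊢
      have hq1 : q (a (i + 1)) < f v := by
        by_contra! hcon
        rw [min_eq_right hcon] at hlt
        exact absurd hlt (not_lt.2 (min_le_right _ _))
      rw [min_eq_left hq1.le] at hlt ⊢
      -- Once the rank is capped at `h`, consecutive thresholds coincide and the gap is empty.
      have hai : a i = 2 ^ i * J := by
        rcases min_choice (2 ^ i * J) h with hc | hc
        · exact hc
        · exfalso
          have h1 : a i = h := hc
          have h2 : a (i + 1) = h :=
            le_antisymm (min_le_right _ _) (h1 ▸ hamono (Nat.le_succ i))
          rw [h1, h2] at hlt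
          exact absurd hlt (not_lt.2 (min_le_left _ _))
      have hQ := (hq _ (ha1 (i + 1)) (ham (i + 1))).2
      have hle1 : a (i + 1) ≤ 2 * a i := by
        rw [hai]
        refine (min_le_left _ _).trans (le_of_eq (by ring))
      have hle2 : a (i + 1) ≤ h := min_le_right _ _
      have hA : a i ≤ (H.filter fun x => min (q (a i)) (f v) ≤ f x).card :=
        (hq _ (ha1 i) (ham i)).1.trans (Finset.card_le_card fun x hx => by
          have := Finset.mem_filter.1 hx
          exact Finset.mem_filter.2 ⟨this.1, (min_le_left _ _).trans this.2⟩)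
      have hmain := hG.card_crossing_ge hlt (ha1 i) hA (by omega) (by omega)
      refine le_trans ?_ hmain
      set Q := (H.filter fun x => q (a (i + 1)) < f x).card with hQd
      have hQ1 : (Q : ℝ) ≤ 2 * a i := by exact_mod_cast (by omega : Q ≤ 2 * a i)
      have hQ2 : 2 * (Q : ℝ) ≤ m := by exact_mod_cast (by omega : 2 * Q ≤ m)
      have haR : (0 : ℝ) < a i := by exact_mod_cast ha1 i
      have hcast : (2 : ℝ) ^ i * J = a i := by rw [hai]; push_cast; ring
      -- From `Q ≤ 2 a` and `Q ≤ m / 2`, the factor `a (m - Q) / m` is at least `1 / (1/a + 4/m)`.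
      -- In this harmonic form the reciprocal of the edge count is a geometric term plus a constant.
      change c / (1 / (2 ^ i * J) + 4 / m) ≤ _
      rw [hcast, ← hm, div_le_div_iff₀ (by positivity) hmR]
      have hexp : c * a i * (m - Q) * (1 / a i + 4 / m) =
          c * ((m - Q) * (m + 4 * a i) / m) := by field_simp
      rw [hexp]
      refine mul_le_mul_of_nonneg_left ?_ hc.le
      rw [le_div_iff₀ hmR]
      have hQ0 : (0 : ℝ) ≤ Q := Nat.cast_nonneg _
      nlinarith
  -- The factor `1 / 2` bounds `(m - Q) / m` from below.
  set e' : ℕ → ℝ := fun i => c * 2 ^ i / 2 with he'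
  have he'count : ∀ i < N, r i < r (i + 1) →
      e' i ≤ (crossing H G f (r (i + 1)) (r i)).card := by
    intro i _ hlt
    have hq1 : q (b i) < f v := by
      by_contra! hcon
      simp only [hr, min_eq_right hcon] at hlt
      exact absurd hlt (not_lt.2 (min_le_right _ _))
    have hri : r i = q (b i) := min_eq_left hq1.le
    have hbi : b i = m + 1 - 2 ^ i ∧ 2 ^ i ≤ h' := by
      rcases le_total (2 ^ i) h' with hc | hc
      · exact ⟨by simp only [hb, min_eq_left hc], hc⟩
      · exfalso
        have h1 : b i = m + 1 - h' := by simp only [hb, min_eq_right hc]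
        have h2 : b (i + 1) = m + 1 - h' := by
          have : h' ≤ 2 ^ (i + 1) := hc.trans (Nat.pow_le_pow_right (by norm_num) (Nat.le_succ i))
          simp only [hb, min_eq_right this]
        simp only [hr, h1, h2, lt_irrefl] at hlt
    have hcompl : ∀ s : ℝ, (H.filter fun x => -s ≤ (-f) x).card +
        (H.filter fun x => s < f x).card = m := by
      intro s
      rw [hm, ← Finset.card_filter_add_card_filter_not (s := H) (fun x => -s ≤ (-f) x)]
      simp only [Pi.neg_apply, neg_le_neg_iff, not_le]
    have hcompl' : ∀ s : ℝ, (H.filter fun x => -s < (-f) x).card +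
        (H.filter fun x => s ≤ f x).card = m := by
      intro s
      rw [hm, ← Finset.card_filter_add_card_filter_not (s := H) (fun x => -s < (-f) x)]
      simp only [Pi.neg_apply, neg_lt_neg_iff, not_lt]
    have c1 := hcompl (r i)
    have c2 := hcompl' (r (i + 1))
    have d1 := (hq _ (hb1 i) (hbm i)).2
    have d2 : b (i + 1) ≤ (H.filter fun x => r (i + 1) ≤ f x).card :=
      (hq _ (hb1 (i + 1)) (hbm (i + 1))).1.trans (Finset.card_le_card fun x hx => by
        have := Finset.mem_filter.1 hx
        exact Finset.mem_filter.2 ⟨this.1, (min_le_left _ _).trans this.2⟩)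
    rw [← hri] at d1
    have d3 : m + 1 ≤ b (i + 1) + min (2 ^ (i + 1)) h' := by simp only [hb]; omega
    have d4 : min (2 ^ (i + 1)) h' ≤ 2 ^ i * 2 := (min_le_left _ _).trans (pow_succ 2 i).le
    have d5 : min (2 ^ (i + 1)) h' ≤ h' := min_le_right _ _
    have d6 : 1 ≤ 2 ^ i := Nat.one_le_two_pow
    -- Below the median the small sets are sublevel sets, so expansion is applied to `-f`.
    have hmain := hG.card_crossing_ge (f := -f) (neg_lt_neg hlt) (a := 2 ^ i) Nat.one_le_two_pow
      (by omega) (by omega) (by omega)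
    rw [card_crossing_neg] at hmain
    refine le_trans ?_ hmain
    set Q := (H.filter fun x => -r (i + 1) < (-f) x).card with hQd
    have hQ2 : 2 * (Q : ℝ) ≤ m := by exact_mod_cast (by omega : 2 * Q ≤ m)
    rw [← hm, le_div_iff₀ hmR]
    simp only [he']
    push_cast
    have : 0 < c * 2 ^ i := by positivity
    nlinarith
  have hE := sum_crossing_le_dirichlet H G f hTanti hrmono hTr hecount he'count
  -- the deviation from the mean
  have hmean : f v - (∑ u ∈ H, f u) / m ≤ ∑ i ∈ Finset.range (N + 1), 1 * (T i - T (i + 1)) +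
      ∑ i ∈ Finset.range N, (2 * 2 ^ i / m) * (r (i + 1) - r i) := by
    have h1 : ∑ i ∈ Finset.range (N + 1), 1 * (T i - T (i + 1)) = f v - r N := by
      simp only [one_mul]
      rw [Finset.sum_range_sub', hTr, hT0]
    -- Each point pays for the gaps above it, and fewer than `2 ^ (i + 1)` points lie below `r (i +
    -- 1)`. Points above `r N` only help.
    have h2 : ∑ x ∈ H, (r N - f x) ≤
        ∑ i ∈ Finset.range N, (2 * 2 ^ i) * (r (i + 1) - r i) := by
      calc ∑ x ∈ H, (r N - f x)
          ≤ ∑ x ∈ H, ∑ i ∈ Finset.range N, (if f x < r (i + 1) then r (i + 1) - r i else 0) := by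
            refine Finset.sum_le_sum fun x hx => le_sum_drops hrmono N ?_
            have hb0 : b 0 = m := by
              have : min (2 ^ 0) h' = 1 := by rw [pow_zero]; exact min_eq_left (by omega)
              simp only [hb, this]; omega
            have := (hq _ (hb1 0) (hbm 0)).1
            rw [hb0] at this
            have heq := Finset.eq_of_subset_of_card_le (Finset.filter_subset _ H) this
            rw [← heq] at hx
            refine (min_le_left _ _).trans ?_
            rw [hb0]
            exact (Finset.mem_filter.1 hx).2
        _ = ∑ i ∈ Finset.range N,
              ((H.filter fun x => f x < r (i + 1)).card : ℝ) * (r (i + 1) - r i) := by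
            rw [Finset.sum_comm]
            refine Finset.sum_congr rfl fun i _ => ?_
            rw [← Finset.sum_filter, Finset.sum_const, nsmul_eq_mul]
        _ ≤ _ := by
            refine Finset.sum_le_sum fun i _ => ?_
            refine mul_le_mul_of_nonneg_right ?_ (sub_nonneg.2 (hrmono (Nat.le_succ i)))
            have d2 : b (i + 1) ≤ (H.filter fun x => r (i + 1) ≤ f x).card :=
              (hq _ (hb1 (i + 1)) (hbm (i + 1))).1.trans (Finset.card_le_card fun x hx => by
                have := Finset.mem_filter.1 hx
                exact Finset.mem_filter.2 ⟨this.1, (min_le_left _ _).trans this.2⟩)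
            have c2 := Finset.card_filter_add_card_filter_not (s := H)
              (fun x => f x < r (i + 1))
            simp only [not_lt] at c2
            have d3 : m + 1 ≤ b (i + 1) + min (2 ^ (i + 1)) h' := by simp only [hb]; omega
            have d4 : min (2 ^ (i + 1)) h' ≤ 2 ^ i * 2 := (min_le_left _ _).trans (pow_succ 2 i).le
            have : (H.filter fun x => f x < r (i + 1)).card ≤ 2 * 2 ^ i := by omega
            exact_mod_cast this
    have h3 : ∑ i ∈ Finset.range N, (2 * 2 ^ i / m) * (r (i + 1) - r i) =
        (∑ i ∈ Finset.range N, (2 * 2 ^ i) * (r (i + 1) - r i)) / m := by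
      rw [Finset.sum_div]
      exact Finset.sum_congr rfl fun i _ => by ring
    rw [h1, h3]
    have h4 : ∑ x ∈ H, (r N - f x) = m * r N - ∑ x ∈ H, f x := by
      rw [Finset.sum_sub_distrib, Finset.sum_const, nsmul_eq_mul]
    rw [h4] at h2
    have h5 : r N - (∑ u ∈ H, f u) / m = (m * r N - ∑ x ∈ H, f x) / m := by field_simp
    have h6 := div_le_div_of_nonneg_right h2 hmR.le
    linarith
  have hR1 : ∑ i ∈ Finset.range (N + 1), 1 ^ 2 / e i ≤
      1 / (d + 1 - J) + (2 / J + 4 * (N : ℝ) / m) / c := by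
    rw [Finset.sum_range_succ']
    have h1 : ∀ i, (1 : ℝ) ^ 2 / e (i + 1) = (1 / 2 ^ i) * (1 / J / c) + 4 / m / c := by
      intro i
      simp only [he]
      field_simp
    have h2 : (1 : ℝ) ^ 2 / e 0 = 1 / (d + 1 - J) := by
      change (1 : ℝ) ^ 2 / (d + 1 - J) = _
      rw [one_pow]
    simp_rw [h1]
    rw [h2, Finset.sum_add_distrib, ← Finset.sum_mul, Finset.sum_const, Finset.card_range,
      nsmul_eq_mul]
    have h3 : (∑ i ∈ Finset.range N, (1 / 2 ^ i : ℝ)) * (1 / J / c) ≤ 2 * (1 / J / c) :=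
      mul_le_mul_of_nonneg_right (sum_inv_two_pow_le N) (by positivity)
    have h4 : (2 / J + 4 * (N : ℝ) / m) / c = 2 * (1 / J / c) + N * (4 / m / c) := by
      field_simp
    rw [h4]
    linarith
  have hR2 : ∑ i ∈ Finset.range N, (2 * 2 ^ i / m : ℝ) ^ 2 / e' i ≤ 8 / (c * m) := by
    have h1 : ∀ i, (2 * 2 ^ i / m : ℝ) ^ 2 / e' i = 2 ^ i * (8 / (c * m ^ 2)) := by
      intro i
      simp only [he']
      field_simp
      norm_num
    simp_rw [h1]
    rw [← Finset.sum_mul]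
    calc _ ≤ (2 : ℝ) ^ N * (8 / (c * m ^ 2)) :=
          mul_le_mul_of_nonneg_right (sum_two_pow_le N) (by positivity)
      _ ≤ m * (8 / (c * m ^ 2)) :=
          mul_le_mul_of_nonneg_right (by exact_mod_cast hN1) (by positivity)
      _ = _ := by field_simp
  have hd0 : 0 < d + 1 - J := by linarith
  refine sq_le_of_sums hf (by positivity) fun l hl => ?_
  have s1 : 2 * ∑ i ∈ Finset.range (N + 1), 1 * (T i - T (i + 1)) ≤
      l * ∑ i ∈ Finset.range (N + 1), 1 ^ 2 / e i +
        (∑ i ∈ Finset.range (N + 1), e i * (T i - T (i + 1)) ^ 2) / l := by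
    rw [Finset.mul_sum, Finset.mul_sum, Finset.sum_div, ← Finset.sum_add_distrib]
    exact Finset.sum_le_sum fun i _ => two_mul_le_div_add (he0 i) hl
  have s2 : 2 * ∑ i ∈ Finset.range N, (2 * 2 ^ i / m) * (r (i + 1) - r i) ≤
      l * ∑ i ∈ Finset.range N, (2 * 2 ^ i / m : ℝ) ^ 2 / e' i +
        (∑ i ∈ Finset.range N, e' i * (r (i + 1) - r i) ^ 2) / l := by
    rw [Finset.mul_sum, Finset.mul_sum, Finset.sum_div, ← Finset.sum_add_distrib]
    exact Finset.sum_le_sum fun i _ => two_mul_le_div_add (by simp only [he']; positivity) hl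
  have s3 := div_le_div_of_nonneg_right hE hl.le
  rw [add_div] at s3
  have s4 := mul_le_mul_of_nonneg_left hR1 hl.le
  have s5 := mul_le_mul_of_nonneg_left hR2 hl.le
  linarith

theorem Expands.potential_bound {n : ℕ} {H : Finset (Fin n)} {G : SimpleGraph (Fin n)}
    {c : ℝ} (hc : 0 < c) (hG : Expands H G c) {v : Fin n} (hv : v ∈ H) {d : ℝ} {J : ℕ}
    (hJ : 2 ≤ J) (hJd : J < d + 1)
    (hdeg : open Classical in d ≤ (H.filter fun w => G.Adj v w).card) (f : Fin n → ℝ) :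
    (f v - (∑ u ∈ H, f u) / H.card) ^ 2 ≤
      (1 / (d + 1 - J) + (2 / J + 4 * (Nat.log 2 H.card : ℝ) / H.card) / c + 8 / (c * H.card)) *
        dirichlet H G f := by
  rcases le_total 0 (f v - (∑ u ∈ H, f u) / H.card) with h | h
  · exact hG.potential_bound_of_nonneg hc hv hJ hJd hdeg f h
  · have h1 : (-f) v - (∑ u ∈ H, (-f) u) / H.card = -(f v - (∑ u ∈ H, f u) / H.card) := by
      simp only [Pi.neg_apply, Finset.sum_neg_distrib]
      ring
    have := hG.potential_bound_of_nonneg hc hv hJ hJd hdeg (-f) (by rw [h1]; linarith)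
    rwa [h1, dirichlet_neg, neg_sq] at this

/-! ### Moment generating functions of random selections -/

/-- The probability that a uniform `k`-set avoids `j` given points is at most that of `j`
independent avoidances: each successive factor is `1 - k / (M + 1)` with `M + 1 ≤ N`. -/
theorem choose_sub_le {N k : ℕ} (hN : 0 < N) (hk : k ≤ N) (j : ℕ) (hj : j ≤ N) :
    ((N - j).choose k : ℝ) ≤ N.choose k * (1 - (k : ℝ) / N) ^ j := by
  have hN' : (0 : ℝ) < N := by exact_mod_cast hN
  have hq : (0 : ℝ) ≤ 1 - (k : ℝ) / N := by
    rw [sub_nonneg, div_le_one hN']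
    exact_mod_cast hk
  induction j with
  | zero => simp
  | succ j ih =>
    obtain ⟨M, hM⟩ : ∃ M, N - j = M + 1 := ⟨N - j - 1, by omega⟩
    have hM2 : N - (j + 1) = M := by omega
    have h1 := Nat.choose_mul_succ_eq M k
    rw [hM] at ih
    rw [hM2]
    by_cases hkM : k ≤ M + 1
    · have h2 : (M.choose k : ℝ) * (M + 1) = (M + 1).choose k * (M + 1 - k) := by
        have : ((M + 1 - k : ℕ) : ℝ) = (M : ℝ) + 1 - k := by rw [Nat.cast_sub hkM]; push_cast; ring
        rw [← this]
        exact_mod_cast h1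
      have hM0 : (0 : ℝ) < M + 1 := by positivity
      have hMN : (M : ℝ) + 1 ≤ N := by exact_mod_cast (by omega : M + 1 ≤ N)
      have h3 : (M.choose k : ℝ) = (M + 1).choose k * (1 - k / (M + 1)) := by
        field_simp
        linarith
      rw [h3, pow_succ, ← mul_assoc]
      refine mul_le_mul (ih (by omega)) ?_ ?_ (by positivity)
      · gcongr
      · rw [sub_nonneg, div_le_one hM0]
        exact_mod_cast hkM
    · rw [Nat.choose_eq_zero_of_lt (by omega)]
      simp only [Nat.cast_zero]
      positivity

/-- A hypergeometric variable has a smaller generating function than the binomial one. Expanding `z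
^ |S ∩ C| = z ^ |C| * ∑ (1/z - 1) ^ |T|` over `T ⊆ C \ S` has nonnegative coefficients and reduces
this to the probability that `S` avoids `T`. -/
theorem sum_pow_card_inter_le {V : Type*} [DecidableEq V] {U C : Finset V} {k : ℕ} (hC : C ⊆ U)
    (hU : 0 < U.card) (hk : k ≤ U.card) {z : ℝ} (hz : 0 < z) (hz1 : z ≤ 1) :
    ∑ S ∈ U.powersetCard k, z ^ (S ∩ C).card ≤
      U.card.choose k * (1 - (k : ℝ) / U.card * (1 - z)) ^ C.card := by
  have h1 : ∀ S : Finset V, z ^ (S ∩ C).card =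
      z ^ C.card * ∑ T ∈ C.powerset, if Disjoint T S then (1 / z - 1) ^ T.card else 0 := by
    intro S
    rw [← Finset.sum_filter]
    have h2 : C.powerset.filter (fun T => Disjoint T S) = (C \ S).powerset := by
      ext T
      simp only [Finset.mem_filter, Finset.mem_powerset, Finset.subset_sdiff]
    have h3 := Finset.sum_pow_mul_eq_add_pow (1 / z - 1) 1 (C \ S)
    simp only [one_pow, mul_one, sub_add_cancel] at h3
    rw [h2, h3]
    have h4 : C.card = (S ∩ C).card + (C \ S).card := by
      rw [Finset.inter_comm, add_comm, Finset.card_sdiff_add_card_inter]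
    rw [h4, pow_add, mul_assoc, ← mul_pow, mul_one_div_cancel hz.ne', one_pow, mul_one]
  have h5 : ∀ T ∈ C.powerset,
      ∑ S ∈ U.powersetCard k, (if Disjoint T S then (1 / z - 1) ^ T.card else 0) =
        ((U.card - T.card).choose k : ℝ) * (1 / z - 1) ^ T.card := by
    intro T hT
    have hTU : T ⊆ U := (Finset.mem_powerset.1 hT).trans hC
    rw [← Finset.sum_filter, Finset.sum_const, nsmul_eq_mul]
    have h6 : (U.powersetCard k).filter (fun S => Disjoint T S) = (U \ T).powersetCard k := by
      ext S
      simp only [Finset.mem_filter, Finset.mem_powersetCard, Finset.subset_sdiff]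
      rw [disjoint_comm]
      tauto
    rw [h6, Finset.card_powersetCard, Finset.card_sdiff_of_subset hTU]
  have hy : 0 ≤ 1 / z - 1 := by
    rw [sub_nonneg, le_div_iff₀ hz]
    linarith
  simp_rw [h1]
  rw [← Finset.mul_sum, Finset.sum_comm, Finset.sum_congr rfl h5]
  calc z ^ C.card * ∑ T ∈ C.powerset, ((U.card - T.card).choose k : ℝ) * (1 / z - 1) ^ T.card
      ≤ z ^ C.card * ∑ T ∈ C.powerset,
          (U.card.choose k : ℝ) * ((1 - (k : ℝ) / U.card) * (1 / z - 1)) ^ T.card := by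
        refine mul_le_mul_of_nonneg_left (Finset.sum_le_sum fun T hT => ?_) (by positivity)
        rw [mul_pow, ← mul_assoc]
        exact mul_le_mul_of_nonneg_right (choose_sub_le hU hk _
          (Finset.card_le_card ((Finset.mem_powerset.1 hT).trans hC))) (by positivity)
    _ = _ := by
        have h3 := Finset.sum_pow_mul_eq_add_pow ((1 - (k : ℝ) / U.card) * (1 / z - 1)) 1 C
        simp only [one_pow, mul_one] at h3
        rw [← Finset.mul_sum, h3, mul_left_comm, ← mul_pow]
        congr 2
        field_simp
        ring

section Selections

variable {n : ℕ} {H : Finset (Fin n)} {k : ℕ}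

theorem card_honestSelections (H : Finset (Fin n)) (k : ℕ) :
    ((honestSelections H k).card : ℝ) = ((n - 1).choose k : ℝ) ^ H.card := by
  unfold honestSelections
  rw [Fintype.card_piFinset]
  simp [Finset.card_powersetCard, Finset.card_erase_of_mem]

theorem sum_pow_card_inter_erase_le (hk : k < n) (u : Fin n) {C : Finset (Fin n)} (hu : u ∉ C)
    (hn : 2 ≤ n) {z : ℝ} (hz : 0 < z) (hz1 : z ≤ 1) :
    ∑ S ∈ (Finset.univ.erase u).powersetCard k, z ^ (S ∩ C).card ≤
      (n - 1).choose k * (1 - (k : ℝ) / (n - 1) * (1 - z)) ^ C.card := by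
  have hcard : (Finset.univ.erase u : Finset (Fin n)).card = n - 1 := by
    rw [Finset.card_erase_of_mem (Finset.mem_univ _), Finset.card_univ, Fintype.card_fin]
  have h := sum_pow_card_inter_le (U := Finset.univ.erase u) (C := C) (k := k)
    (fun x hx => Finset.mem_erase.2 ⟨fun h => hu (h ▸ hx), Finset.mem_univ _⟩)
    (by omega) (by omega) hz hz1
  rw [hcard, Nat.cast_sub (by omega), Nat.cast_one] at h
  exact h

/-- The number of selections that the members of `A` make in `C`. -/
def picks (A C : Finset (Fin n)) (c : {u // u ∈ H} → Finset (Fin n)) : ℕ :=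
  ∑ u : {u // u ∈ H}, if u.1 ∈ A then (c u ∩ C).card else 0

theorem sum_pow_picks_le (hk : k < n) (hn : 2 ≤ n) {A C : Finset (Fin n)} (hA : A ⊆ H)
    (hAC : Disjoint A C) {z : ℝ} (hz : 0 < z) (hz1 : z ≤ 1) :
    ∑ c ∈ honestSelections H k, z ^ picks A C c ≤
      (honestSelections H k).card * ((1 - (k : ℝ) / (n - 1) * (1 - z)) ^ C.card) ^ A.card := by
  set b := (1 - (k : ℝ) / (n - 1) * (1 - z)) ^ C.card with hb
  have h1 : ∀ c : {u // u ∈ H} → Finset (Fin n), z ^ picks A C c =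
      ∏ u : {u // u ∈ H}, (if u.1 ∈ A then z ^ (c u ∩ C).card else 1) := by
    intro c
    rw [picks, ← Finset.prod_pow_eq_pow_sum]
    refine Finset.prod_congr rfl fun u _ => ?_
    split_ifs <;> simp
  simp_rw [h1]
  unfold honestSelections
  rw [← Finset.prod_univ_sum (fun u : {u // u ∈ H} => (Finset.univ.erase u.1).powersetCard k)
    (fun u s => if u.1 ∈ A then z ^ (s ∩ C).card else 1)]
  have hcard := card_honestSelections H k
  unfold honestSelections at hcard
  rw [hcard]
  calc _ ≤ ∏ u : {u // u ∈ H}, ((n - 1).choose k : ℝ) * (if u.1 ∈ A then b else 1) := by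
        refine Finset.prod_le_prod (fun u _ => Finset.sum_nonneg fun s _ => ?_) fun u _ => ?_
        · split_ifs <;> positivity
        · split_ifs with hu
          · exact sum_pow_card_inter_erase_le hk u.1 (Finset.disjoint_left.1 hAC hu) hn hz hz1
          · simp [Finset.card_powersetCard, Finset.card_erase_of_mem]
    _ = _ := by
        rw [Finset.prod_mul_distrib, Finset.prod_const, Finset.card_univ, Fintype.card_coe]
        congr 1
        rw [Finset.prod_coe_sort H (fun u => if u ∈ A then b else 1), Finset.prod_ite,
          Finset.prod_const, Finset.prod_const_one, mul_one, Finset.filter_mem_eq_inter,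
          Finset.inter_eq_right.2 hA]

/-- The number of honest neighbours of `v` when the honest users select `c`. -/
def honestDegree (v : {u // u ∈ H}) (c : {u // u ∈ H} → Finset (Fin n)) : ℕ :=
  ((Finset.univ.erase v).filter fun w => w.1 ∈ c v ∨ v.1 ∈ c w).card

/-- Condition on the selection `S` of `v`. Users in `S` contribute `z`, and each other honest user
independently contributes `b = 1 - κ (1 - z)` on average. What remains is `b ^ (|H| - 1)` times a
generating function of `|S ∩ W|` at `z / b ≤ 1`. -/
theorem sum_pow_honestDegree_le (hk : k < n) (hn : 2 ≤ n) (v : {u // u ∈ H}) {z : ℝ} (hz : 0 < z)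
    (hz1 : z ≤ 1) :
    ∑ c ∈ honestSelections H k, z ^ honestDegree v c ≤
      (honestSelections H k).card *
        ((1 - (k : ℝ) / (n - 1) * (1 - z)) * (1 - (k : ℝ) / (n - 1)) + (k : ℝ) / (n - 1) * z) ^
          (H.card - 1) := by
  set κ : ℝ := (k : ℝ) / (n - 1) with hκ
  have hn' : (0 : ℝ) < (n : ℝ) - 1 := by
    have : (2 : ℝ) ≤ n := by exact_mod_cast hn
    linarith
  have hκ0 : 0 ≤ κ := by positivity
  have hκ1 : κ ≤ 1 := by
    rw [hκ, div_le_one hn']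
    have : ((k + 1 : ℕ) : ℝ) ≤ n := by exact_mod_cast hk
    push_cast at this
    linarith
  set b : ℝ := 1 - κ * (1 - z) with hb
  have hzb : z ≤ b := by rw [hb]; nlinarith
  have hb0 : 0 < b := hz.trans_le hzb
  set W : Finset (Fin n) := H.erase v with hW
  set P : Finset (Finset (Fin n)) := (Finset.univ.erase v.1).powersetCard k with hP
  -- For fixed `S`, this factorises over users the generating function on the event that `v` selects
  -- `S`, so sums over the product set become products of sums.
  set g : Finset (Fin n) → {u // u ∈ H} → Finset (Fin n) → ℝ := fun S u s =>
    if u = v then (if s = S then z ^ (S ∩ W).card else 0)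
    else if u.1 ∈ S then 1 else z ^ (s ∩ {v.1}).card with hg
  have hWcard : W.card = H.card - 1 := Finset.card_erase_of_mem v.2
  have hcount : ∀ (p : Fin n → Prop) [DecidablePred p],
      ((Finset.univ.erase v).filter fun w : {u // u ∈ H} => p w.1).card = (W.filter p).card := by
    intro p _
    refine Finset.card_bij (fun w _ => w.1) ?_ (fun a _ b _ h => Subtype.ext h) ?_
    · intro w hw
      have hw' := Finset.mem_filter.1 hw
      exact Finset.mem_filter.2 ⟨Finset.mem_erase.2
        ⟨fun h => (Finset.mem_erase.1 hw'.1).1 (Subtype.ext h), w.2⟩, hw'.2⟩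
    · intro w hw
      have hw' := Finset.mem_filter.1 hw
      have hw2 := Finset.mem_erase.1 hw'.1
      exact ⟨⟨w, hw2.2⟩, Finset.mem_filter.2 ⟨Finset.mem_erase.2
        ⟨fun h => hw2.1 (congrArg Subtype.val h), Finset.mem_univ _⟩, hw'.2⟩, rfl⟩
  have h1 : ∀ c ∈ honestSelections H k, z ^ honestDegree v c = ∑ S ∈ P, ∏ u, g S u (c u) := by
    intro c hc
    have hcv : c v ∈ P := Fintype.mem_piFinset.1 hc v
    rw [Finset.sum_eq_single_of_mem (c v) hcv]
    · rw [← Finset.mul_prod_erase Finset.univ _ (Finset.mem_univ v)]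
      have h2 : g (c v) v (c v) = z ^ (c v ∩ W).card := by simp [hg]
      have h3 : ∏ u ∈ Finset.univ.erase v, g (c v) u (c u) =
          ∏ u ∈ Finset.univ.erase v,
            z ^ (if u.1 ∉ c v ∧ v.1 ∈ c u then 1 else 0) := by
        refine Finset.prod_congr rfl fun u hu => ?_
        simp only [hg]
        rw [if_neg (Finset.mem_erase.1 hu).1]
        by_cases h4 : u.1 ∈ c v
        · simp [h4]
        · by_cases h5 : v.1 ∈ c u
          · simp [h4, h5]
          · simp [h4, h5]
      rw [h2, h3, Finset.prod_pow_eq_pow_sum, Finset.sum_boole, ← pow_add, honestDegree]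
      congr 1
      have h6 : c v ∩ W = W.filter fun w => w ∈ c v := by
        rw [Finset.filter_mem_eq_inter, Finset.inter_comm]
      rw [h6, ← hcount, Nat.cast_id, ← Finset.card_union_of_disjoint]
      · congr 1
        ext w
        simp only [Finset.mem_union, Finset.mem_filter]
        tauto
      · rw [Finset.disjoint_left]
        intro w hw hw'
        exact (Finset.mem_filter.1 hw').2.1 (Finset.mem_filter.1 hw).2
    · intro S _ hS
      refine Finset.prod_eq_zero (Finset.mem_univ v) ?_
      simp [hg, hS.symm]
  rw [Finset.sum_congr rfl h1, Finset.sum_comm]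
  have hC0 : (0 : ℝ) ≤ ((n - 1).choose k : ℝ) := Nat.cast_nonneg _
  have h2 : ∀ S ∈ P, ∑ c ∈ honestSelections H k, ∏ u, g S u (c u) ≤
      ((n - 1).choose k : ℝ) ^ (H.card - 1) * b ^ (H.card - 1) * (z / b) ^ (S ∩ W).card := by
    intro S hS
    unfold honestSelections
    rw [← Finset.prod_univ_sum (fun u : {u // u ∈ H} => (Finset.univ.erase u.1).powersetCard k)
      (g S), ← Finset.mul_prod_erase Finset.univ _ (Finset.mem_univ v)]
    have h3 : ∑ s ∈ (Finset.univ.erase v.1).powersetCard k, g S v s = z ^ (S ∩ W).card := by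
      simp only [hg, if_true]
      rw [Finset.sum_ite_eq' _ S, if_pos hS]
    rw [h3]
    have h4 : ∏ u ∈ Finset.univ.erase v, ∑ s ∈ (Finset.univ.erase u.1).powersetCard k, g S u s ≤
        ∏ u ∈ Finset.univ.erase v, ((n - 1).choose k : ℝ) * (if u.1 ∉ S then b else 1) := by
      refine Finset.prod_le_prod (fun u _ => Finset.sum_nonneg fun s _ => ?_) fun u hu => ?_
      · simp only [hg]
        split_ifs <;> positivity
      · have huv := (Finset.mem_erase.1 hu).1
        simp only [hg, if_neg huv]
        by_cases hu2 : u.1 ∈ S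
        · simp [hu2, Finset.card_powersetCard, Finset.card_erase_of_mem]
        · simp only [hu2, if_false, not_false_eq_true, if_true]
          have := sum_pow_card_inter_erase_le hk u.1 (C := {v.1})
            (fun h => huv (Subtype.ext (Finset.mem_singleton.1 h))) hn hz hz1
          simpa using this
    have h5 : ∏ u ∈ Finset.univ.erase v, ((n - 1).choose k : ℝ) * (if u.1 ∉ S then b else 1) =
        ((n - 1).choose k : ℝ) ^ (H.card - 1) * b ^ (W.filter fun w => w ∉ S).card := by
      rw [Finset.prod_mul_distrib, Finset.prod_const, Finset.card_erase_of_mem (Finset.mem_univ _),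
        Finset.card_univ, Fintype.card_coe, Finset.prod_ite, Finset.prod_const,
        Finset.prod_const_one, mul_one, hcount fun w => w ∉ S]
    have h6 : (S ∩ W).card + (W.filter fun w => w ∉ S).card = H.card - 1 := by
      rw [← hWcard, ← Finset.card_filter_add_card_filter_not (s := W) (fun w => w ∈ S),
        Finset.filter_mem_eq_inter, Finset.inter_comm]
    calc _ ≤ z ^ (S ∩ W).card *
          (((n - 1).choose k : ℝ) ^ (H.card - 1) * b ^ (W.filter fun w => w ∉ S).card) := by
          rw [← h5]
          gcongr
      _ = _ := by
          rw [← h6, pow_add b, div_pow]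
          field_simp
  refine (Finset.sum_le_sum h2).trans ?_
  rw [← Finset.mul_sum]
  have h7 := sum_pow_card_inter_erase_le hk v.1 (C := W) (Finset.notMem_erase _ _) hn
    (z := z / b) (by positivity) (by rw [div_le_one hb0]; exact hzb)
  rw [hWcard] at h7
  refine (mul_le_mul_of_nonneg_left h7 (by positivity)).trans (le_of_eq ?_)
  have h8 : H.card = H.card - 1 + 1 := by
    have := Finset.card_pos.2 ⟨v.1, v.2⟩
    omega
  have h9 : b * (1 - κ * (1 - z / b)) = b * (1 - κ) + κ * z := by
    field_simp
    ring
  rw [card_honestSelections, ← h9, mul_pow, ← hκ]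
  nth_rewrite 4 [h8]
  rw [pow_succ]
  ring

end Selections

/-! ### Tail bounds for random selections -/

/-- Markov's inequality for `z ^ X`, in counting form. -/
theorem card_filter_lt_mul_rpow_le {α : Type*} (F : Finset α) (X : α → ℕ) {z θ B : ℝ} (hz : 0 < z)
    (hz1 : z ≤ 1) (h : ∑ c ∈ F, z ^ X c ≤ F.card * B) :
    ((F.filter fun c => (X c : ℝ) < θ).card : ℝ) * z ^ θ ≤ F.card * B := by
  calc ((F.filter fun c => (X c : ℝ) < θ).card : ℝ) * z ^ θ
      = ∑ c ∈ F.filter fun c => (X c : ℝ) < θ, z ^ θ := by rw [Finset.sum_const, nsmul_eq_mul]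
    _ ≤ ∑ c ∈ F.filter fun c => (X c : ℝ) < θ, z ^ X c := by
        refine Finset.sum_le_sum fun c hc => ?_
        rw [← Real.rpow_natCast]
        exact Real.rpow_le_rpow_of_exponent_ge hz hz1 (Finset.mem_filter.1 hc).2.le
    _ ≤ ∑ c ∈ F, z ^ X c :=
        Finset.sum_le_sum_of_subset_of_nonneg (Finset.filter_subset _ _) fun _ _ _ => by positivity
    _ ≤ _ := h

theorem log_five_lt : Real.log 5 < 1.61 := by
  have h1 : Real.log ((5 : ℝ) ^ 31) ≤ Real.log ((2 : ℝ) ^ 72) :=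
    Real.log_le_log (by positivity) (by norm_num)
  rw [Real.log_pow, Real.log_pow] at h1
  have h2 := Real.log_two_lt_d9
  push_cast at h1
  linarith

theorem log_three_gt : 1.0985 < Real.log 3 := by
  have h1 : Real.log ((2 : ℝ) ^ 84) ≤ Real.log ((3 : ℝ) ^ 53) :=
    Real.log_le_log (by positivity) (by norm_num)
  rw [Real.log_pow, Real.log_pow] at h1
  have h2 := Real.log_two_gt_d9
  push_cast at h1
  linarith

theorem log_three_lt : Real.log 3 < 1.0989 := by
  have h1 : Real.log ((3 : ℝ) ^ 41) ≤ Real.log ((2 : ℝ) ^ 65) :=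
    Real.log_le_log (by positivity) (by norm_num)
  rw [Real.log_pow, Real.log_pow] at h1
  have h2 := Real.log_two_lt_d9
  push_cast at h1
  linarith

/-- The left side is the factor per user in the degree generating function at `z = 1/5`. A Taylor
estimate of `exp (-0.755 x)` is squared, which keeps its argument small. -/
theorem quadratic_le_exp {x : ℝ} (h0 : 0 ≤ x) (h1 : x ≤ 1) :
    1 - 1.6 * x + 0.8 * x ^ 2 ≤ Real.exp (-(1.51 * x)) := by
  have hb := Real.exp_bound (x := -(0.755 * x)) (n := 5)
    (by rw [abs_neg, abs_of_nonneg (by positivity)]; linarith) (by norm_num)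
  have hb' := (abs_le.1 hb).1
  rw [abs_neg, abs_of_nonneg (by positivity : 0 ≤ 0.755 * x)] at hb'
  norm_num [Finset.sum_range_succ, Nat.factorial] at hb'
  have hx3 : x ^ 3 ≤ x ^ 2 := pow_le_pow_of_le_one h0 h1 (by norm_num)
  have hx5 : x ^ 5 ≤ x ^ 4 := pow_le_pow_of_le_one h0 h1 (by norm_num)
  have hx4 : 0 ≤ x ^ 4 := by positivity
  have hp : 1 - 0.755 * x + 0.213 * x ^ 2 ≤ Real.exp (-(0.755 * x)) := by
    norm_num
    nlinarith
  have hp0 : 0 ≤ 1 - 0.755 * x + 0.213 * x ^ 2 := by nlinarith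
  have hsq : Real.exp (-(1.51 * x)) = Real.exp (-(0.755 * x)) ^ 2 := by
    rw [← Real.exp_nat_mul]
    congr 1
    push_cast
    ring
  rw [hsq]
  refine le_trans ?_ (pow_le_pow_left₀ hp0 hp 2)
  have : 0 ≤ x * (0.09 + 0.196025 * x - 0.32163 * x ^ 2 + 0.0453 * x ^ 3) := by
    refine mul_nonneg h0 ?_
    nlinarith [mul_nonneg h0 (sub_nonneg.2 h1), pow_nonneg h0 3,
      mul_nonneg (mul_nonneg h0 h0) (sub_nonneg.2 h1)]
  nlinarith [pow_nonneg h0 4]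

section Tails

variable {n : ℕ} {H : Finset (Fin n)} {k : ℕ}

theorem selectProb_ge (hn : 2 ≤ n) : (k : ℝ) / n ≤ (k : ℝ) / (n - 1) := by
  have : (2 : ℝ) ≤ n := by exact_mod_cast hn
  gcongr <;> linarith

theorem selectProb_le_one (hk : k < n) (hn : 2 ≤ n) : (k : ℝ) / (n - 1) ≤ 1 := by
  have h2 : (2 : ℝ) ≤ n := by exact_mod_cast hn
  rw [div_le_one (by linarith)]
  have : ((k + 1 : ℕ) : ℝ) ≤ n := by exact_mod_cast hk
  push_cast at this
  linarith

/-- Chernoff with `z = 1/5`. Counting selections in both directions gives the decay rate `1.51`; the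
threshold costs `0.78 log 5 < 1.26`, which leaves `1/4`. The `1.51` in the exponent is the price of
`|H| - 1` in place of `|H|`. -/
theorem card_honestDegree_lt_le (hk : k < n) (hn : 2 ≤ n) (v : {u // u ∈ H}) {L : ℝ}
    (hL : L = (k : ℝ) / n * H.card) :
    (((honestSelections H k).filter fun c => (honestDegree v c : ℝ) < 0.78 * L).card : ℝ) ≤
      (honestSelections H k).card * Real.exp (1.51 - L / 4) := by
  set κ : ℝ := (k : ℝ) / (n - 1) with hκ
  have h2 : (2 : ℝ) ≤ n := by exact_mod_cast hn
  have hκ1 : κ ≤ 1 := selectProb_le_one hk hn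
  have hκ0 : 0 ≤ κ := div_nonneg (Nat.cast_nonneg _) (by linarith)
  have hL0 : 0 ≤ L := by rw [hL]; positivity
  have hm : 1 ≤ H.card := Finset.card_pos.2 ⟨v.1, v.2⟩
  have hmn : (H.card : ℝ) ≤ n := by
    have := Finset.card_le_univ H
    rw [Fintype.card_fin] at this
    exact_mod_cast this
  have hmR : (1 : ℝ) ≤ H.card := by exact_mod_cast hm
  have hκm : L - 1 ≤ κ * (H.card - 1) := by
    have hkn : (k : ℝ) + 1 ≤ n := by exact_mod_cast hk
    have h3 : κ * (H.card - 1) - (L - 1) =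
        (n * (n - 1) - k * (n - H.card)) / (n * (n - 1)) := by
      rw [hκ, hL]
      have : (n : ℝ) - 1 ≠ 0 := by linarith
      field_simp
      ring
    have h4 : 0 ≤ (n * (n - 1) - k * (n - H.card)) / ((n : ℝ) * (n - 1)) := by
      refine div_nonneg ?_ (by nlinarith)
      nlinarith [mul_nonneg (Nat.cast_nonneg (α := ℝ) k) (by linarith : (0 : ℝ) ≤ H.card)]
    linarith
  have hmain := card_filter_lt_mul_rpow_le (honestSelections H k) (honestDegree v)
    (z := 1 / 5) (θ := 0.78 * L) (by norm_num) (by norm_num)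
    (sum_pow_honestDegree_le hk hn v (by norm_num) (by norm_num))
  rw [← hκ] at hmain
  set Y := (((honestSelections H k).filter fun c => (honestDegree v c : ℝ) < 0.78 * L).card : ℝ)
  have hY : 0 ≤ Y := Nat.cast_nonneg _
  have hbase : ((1 - κ * (1 - 1 / 5)) * (1 - κ) + κ * (1 / 5)) ^ (H.card - 1) ≤
      Real.exp (-(1.51 * (L - 1))) := by
    have h3 : (1 - κ * (1 - 1 / 5)) * (1 - κ) + κ * (1 / 5) = 1 - 1.6 * κ + 0.8 * κ ^ 2 := by ring
    rw [h3]
    calc _ ≤ Real.exp (-(1.51 * κ)) ^ (H.card - 1) :=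
          pow_le_pow_left₀ (by nlinarith [sq_nonneg (1 - κ)]) (quadratic_le_exp hκ0 hκ1) _
      _ = Real.exp (-(1.51 * (κ * (H.card - 1)))) := by
          rw [← Real.exp_nat_mul, Nat.cast_sub hm]
          congr 1
          push_cast
          ring
      _ ≤ _ := Real.exp_le_exp.2 (by linarith)
  have hpow : Real.exp (-(1.26 * L)) ≤ (1 / 5 : ℝ) ^ (0.78 * L) := by
    rw [Real.rpow_def_of_pos (by norm_num), one_div, Real.log_inv]
    refine Real.exp_le_exp.2 ?_
    have := log_five_lt
    nlinarith
  have h5 : Y * Real.exp (-(1.26 * L)) ≤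
      (honestSelections H k).card * Real.exp (-(1.51 * (L - 1))) :=
    (mul_le_mul_of_nonneg_left hpow hY).trans
      (hmain.trans (mul_le_mul_of_nonneg_left hbase (Nat.cast_nonneg _)))
  have h6 : Y = Y * Real.exp (-(1.26 * L)) * Real.exp (1.26 * L) := by
    rw [mul_assoc, ← Real.exp_add]
    simp
  rw [h6]
  calc _ ≤ (honestSelections H k).card * Real.exp (-(1.51 * (L - 1))) * Real.exp (1.26 * L) :=
        mul_le_mul_of_nonneg_right h5 (Real.exp_pos _).le
    _ = (honestSelections H k).card * Real.exp (1.51 - L / 4) := by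
        rw [mul_assoc, ← Real.exp_add]
        congr 2
        ring

/-- Chernoff with `z = 1/8`, where `M` is at most the mean: the rate is `7/8 - (log 8) / 8 > 0.615`.
-/
theorem card_picks_lt_le (hk : k < n) (hn : 2 ≤ n) {A C : Finset (Fin n)} (hA : A ⊆ H)
    (hAC : Disjoint A C) {M : ℝ} (hM : M = (k : ℝ) / n * A.card * C.card) :
    (((honestSelections H k).filter fun c => (picks A C c : ℝ) < M / 8).card : ℝ) ≤
      (honestSelections H k).card * Real.exp (-(0.615 * M)) := by
  set κ : ℝ := (k : ℝ) / (n - 1) with hκ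
  have hκ1 : κ ≤ 1 := selectProb_le_one hk hn
  have hκn : (k : ℝ) / n ≤ κ := selectProb_ge hn
  have hM0 : 0 ≤ M := by rw [hM]; positivity
  have hmain := card_filter_lt_mul_rpow_le (honestSelections H k) (picks A C)
    (z := 1 / 8) (θ := M / 8) (by norm_num) (by norm_num)
    (sum_pow_picks_le hk hn hA hAC (by norm_num) (by norm_num))
  rw [← hκ] at hmain
  set Y := (((honestSelections H k).filter fun c => (picks A C c : ℝ) < M / 8).card : ℝ)
  have hY : 0 ≤ Y := Nat.cast_nonneg _
  have hbase : ((1 - κ * (1 - 1 / 8)) ^ C.card) ^ A.card ≤ Real.exp (-(7 / 8 * M)) := by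
    rw [← pow_mul]
    calc _ ≤ Real.exp (-(κ * (7 / 8))) ^ (C.card * A.card) := by
          refine pow_le_pow_left₀ (by linarith) ?_ _
          have := Real.add_one_le_exp (-(κ * (7 / 8)))
          linarith
      _ = Real.exp (-(7 / 8 * (κ * A.card * C.card))) := by
          rw [← Real.exp_nat_mul]
          congr 1
          push_cast
          ring
      _ ≤ _ := by
          refine Real.exp_le_exp.2 ?_
          rw [hM]
          have : (k : ℝ) / n * A.card * C.card ≤ κ * A.card * C.card := by gcongr
          linarith
  have hpow : Real.exp (-(0.26 * M)) ≤ (1 / 8 : ℝ) ^ (M / 8) := by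
    rw [Real.rpow_def_of_pos (by norm_num), one_div, Real.log_inv,
      show (8 : ℝ) = 2 ^ 3 by norm_num, Real.log_pow]
    refine Real.exp_le_exp.2 ?_
    have := Real.log_two_lt_d9
    push_cast
    nlinarith
  have h5 : Y * Real.exp (-(0.26 * M)) ≤
      (honestSelections H k).card * Real.exp (-(7 / 8 * M)) :=
    (mul_le_mul_of_nonneg_left hpow hY).trans
      (hmain.trans (mul_le_mul_of_nonneg_left hbase (Nat.cast_nonneg _)))
  have h6 : Y = Y * Real.exp (-(0.26 * M)) * Real.exp (0.26 * M) := by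
    rw [mul_assoc, ← Real.exp_add]
    simp
  rw [h6]
  calc _ ≤ (honestSelections H k).card * Real.exp (-(7 / 8 * M)) * Real.exp (0.26 * M) :=
        mul_le_mul_of_nonneg_right h5 (Real.exp_pos _).le
    _ = (honestSelections H k).card * Real.exp (-(0.615 * M)) := by
        rw [mul_assoc, ← Real.exp_add]
        congr 2
        ring

end Tails

/-! ### Counting sets -/

theorem one_add_div_pow_le_exp {a m : ℕ} (hm : 0 < m) : (1 + (a : ℝ) / m) ^ m ≤ Real.exp a := by
  have hm' : (0 : ℝ) < m := by exact_mod_cast hm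
  calc (1 + (a : ℝ) / m) ^ m ≤ Real.exp (a / m) ^ m := by
        refine pow_le_pow_left₀ (by positivity) ?_ _
        have := Real.add_one_le_exp ((a : ℝ) / m)
        linarith
    _ = Real.exp a := by
        rw [← Real.exp_nat_mul]
        congr 1
        field_simp

/-- Give `B` the weight `(a/m) ^ |B| * (m/a) ^ (a - 1)`, which is at least `1` when `|B| < a`. Over
all subsets the weights sum to `(1 + a/m) ^ m * (m/a) ^ (a - 1)`. -/
theorem card_small_subsets_le {V : Type*} (H : Finset V) {a : ℕ} (ha : 1 ≤ a) (ham : a ≤ H.card) :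
    ((H.powerset.filter fun B => B.card < a).card : ℝ) ≤
      Real.exp (a + (a - 1) * Real.log (H.card / a)) := by
  have hm : 0 < H.card := by omega
  have hmR : (0 : ℝ) < H.card := by exact_mod_cast hm
  have haR : (0 : ℝ) < a := by exact_mod_cast ha
  have hma : (a : ℝ) / H.card ≤ 1 := by
    rw [div_le_one hmR]; exact_mod_cast ham
  have hexp : Real.exp (((a : ℝ) - 1) * Real.log (H.card / a)) = ((H.card : ℝ) / a) ^ (a - 1) := by
    rw [← Real.exp_log (by positivity : (0 : ℝ) < H.card / a), ← Real.exp_nat_mul, Nat.cast_sub ha,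
      Real.log_exp, Nat.cast_one]
  rw [Real.exp_add, hexp]
  have h1 := Finset.sum_pow_mul_eq_add_pow ((a : ℝ) / H.card) 1 H
  simp only [one_pow, mul_one] at h1
  rw [add_comm] at h1
  calc ((H.powerset.filter fun B => B.card < a).card : ℝ)
      = ∑ B ∈ H.powerset.filter fun B => B.card < a, 1 := by simp
    _ ≤ ∑ B ∈ H.powerset.filter fun B => B.card < a,
          ((a : ℝ) / H.card) ^ B.card * ((H.card : ℝ) / a) ^ (a - 1) := by
        refine Finset.sum_le_sum fun B hB => ?_
        have hB' : B.card ≤ a - 1 := by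
          have := (Finset.mem_filter.1 hB).2
          omega
        have h2 : ((a : ℝ) / H.card) ^ (a - 1) ≤ ((a : ℝ) / H.card) ^ B.card :=
          pow_le_pow_of_le_one (by positivity) hma hB'
        calc (1 : ℝ) = ((a : ℝ) / H.card) ^ (a - 1) * ((H.card : ℝ) / a) ^ (a - 1) := by
              rw [← mul_pow, div_mul_div_cancel₀ hmR.ne', div_self haR.ne', one_pow]
          _ ≤ _ := mul_le_mul_of_nonneg_right h2 (by positivity)
    _ ≤ ∑ B ∈ H.powerset, ((a : ℝ) / H.card) ^ B.card * ((H.card : ℝ) / a) ^ (a - 1) :=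
        Finset.sum_le_sum_of_subset_of_nonneg (Finset.filter_subset _ _) fun _ _ _ => by positivity
    _ = (1 + (a : ℝ) / H.card) ^ H.card * ((H.card : ℝ) / a) ^ (a - 1) := by
        rw [← Finset.sum_mul, h1]
    _ ≤ _ := mul_le_mul_of_nonneg_right (one_add_div_pow_le_exp hm) (by positivity)

theorem choose_le_exp {m a : ℕ} (ha : 1 ≤ a) (ham : a ≤ m) :
    (m.choose a : ℝ) ≤ Real.exp (a + a * Real.log (m / a)) := by
  have hm : 0 < m := by omega
  have hmR : (0 : ℝ) < m := by exact_mod_cast hm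
  have haR : (0 : ℝ) < a := by exact_mod_cast ha
  have hexp : Real.exp ((a : ℝ) * Real.log (m / a)) = ((m : ℝ) / a) ^ a := by
    rw [← Real.exp_log (by positivity : (0 : ℝ) < m / a), ← Real.exp_nat_mul, Real.log_exp]
  rw [Real.exp_add, hexp]
  have h1 := add_pow ((a : ℝ) / m) 1 m
  simp only [one_pow, mul_one] at h1
  rw [add_comm] at h1
  have h2 : ((a : ℝ) / m) ^ a * m.choose a ≤ (1 + (a : ℝ) / m) ^ m := by
    rw [h1]
    exact Finset.single_le_sum (f := fun j => ((a : ℝ) / m) ^ j * (m.choose j : ℝ))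
      (fun j _ => by positivity) (Finset.mem_range.2 (by omega))
  have h3 : (m.choose a : ℝ) = ((a : ℝ) / m) ^ a * m.choose a * ((m : ℝ) / a) ^ a := by
    rw [mul_right_comm, ← mul_pow, div_mul_div_cancel₀ hmR.ne', div_self haR.ne', one_pow, one_mul]
  rw [h3]
  exact mul_le_mul_of_nonneg_right (h2.trans (one_add_div_pow_le_exp hm)) (by positivity)

/-- After multiplication by `X`, and at `L = 19.77`, the difference of the sides is a concave
quadratic in `X`, positive at both ends of `[4, 10]`. -/
theorem ratio_le_of_mem_Icc {X L : ℝ} (h4 : 4 ≤ X) (h10 : X ≤ 10) (hL : 19.77 ≤ L) :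
    4.28 + X / 3 ≤ L * (0.615 - 1.23 / X - X / 324) := by
  have hX0 : 0 < X := by linarith
  have e1 : L * (0.615 - 1.23 / X - X / 324) =
      L * (0.615 * X - 1.23 - X ^ 2 / 324) / X := by field_simp
  rw [e1, le_div_iff₀ hX0]
  have hq : 0 ≤ (X - 4) * (10 - X) := mul_nonneg (by linarith) (by linarith)
  have e2 : 0 ≤ 0.615 * X - 1.23 - X ^ 2 / 324 := by linarith
  have e3 : 19.77 * (0.615 * X - 1.23 - X ^ 2 / 324) ≤
      L * (0.615 * X - 1.23 - X ^ 2 / 324) := mul_le_mul_of_nonneg_right hL e2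
  linarith

/-- The exponent of the union bound over sets of size `a`. -/
theorem union_exponent_le {m a : ℕ} (hm : 81 ≤ m) (ha : 1 ≤ a) (ham : 2 * a ≤ m) {L δ W : ℝ}
    (hδ : 0 < δ) (hL1 : 4 * Real.log (2 * m / (3 * δ)) ≤ L) (hL2 : 6 * Real.log (m / 3) ≤ L)
    (hW1 : 0.615 * (L * a * (1 - 2 * a / m)) ≤ W) (hW2 : 0.615 * (L * a * (1 / 2)) ≤ W) :
    2 * a + (2 * a - 1) * Real.log (m / a) - W ≤ Real.log δ - a * Real.log 2 := by
  have hmR : (81 : ℝ) ≤ m := by exact_mod_cast hm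
  have hm0 : (0 : ℝ) < m := by linarith
  have haR : (1 : ℝ) ≤ a := by exact_mod_cast ha
  have ha0 : (0 : ℝ) < a := by linarith
  have hamR : 2 * (a : ℝ) ≤ m := by exact_mod_cast ham
  set l := Real.log (m / a) with hl
  have hlm : Real.log m = l + Real.log a := by
    rw [hl, Real.log_div hm0.ne' ha0.ne']
    ring
  have t2 := Real.log_two_lt_d9
  have t2' := Real.log_two_gt_d9
  have t3 := log_three_lt
  have t3' := log_three_gt
  have hL1' : 4 * (Real.log 2 + l + Real.log a - Real.log 3 - Real.log δ) ≤ L := by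
    rw [Real.log_div (by positivity) (by positivity), Real.log_mul (by norm_num) hm0.ne',
      Real.log_mul (by norm_num) hδ.ne', hlm] at hL1
    linarith
  have hL2' : 6 * (l + Real.log a - Real.log 3) ≤ L := by
    rw [Real.log_div hm0.ne' (by norm_num), hlm] at hL2
    linarith
  have hL3 : 19.77 ≤ L := by
    have h1 : Real.log ((3 : ℝ) ^ 3) ≤ Real.log (m / 3) :=
      Real.log_le_log (by norm_num) (by rw [le_div_iff₀ (by norm_num)]; linarith)
    rw [Real.log_pow] at h1
    push_cast at h1
    linarith
  have hl0 : 0 ≤ l := Real.log_nonneg (by rw [le_div_iff₀ ha0]; linarith)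
  have hloga : 0 ≤ Real.log a := Real.log_nonneg haR
  -- The first lower bound on `L` replaces `log δ` at the cost of `L / 4`, and absorbs one of the `2
  -- a - 1` logarithms.
  suffices h : 2 * a + (2 * a - 2) * l + L / 4 - Real.log a + (Real.log 3 - Real.log 2) +
      a * Real.log 2 ≤ W by linarith
  rcases le_or_gt (10 * (a : ℝ)) m with h10 | h10
  · have hω : 0.8 ≤ 1 - 2 * (a : ℝ) / m := by
      have : 2 * (a : ℝ) / m ≤ 0.2 := by rw [div_le_iff₀ hm0]; linarith
      linarith
    have hW : 0.492 * (L * a) ≤ W := by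
      have : L * a * 0.8 ≤ L * a * (1 - 2 * a / m) :=
        mul_le_mul_of_nonneg_left hω (by positivity)
      linarith
    rcases Nat.lt_or_ge a 3 with h3 | h3
    · interval_cases a
      · norm_num at *
        linarith
      · norm_num at *
        linarith
    · have h3R : (3 : ℝ) ≤ a := by exact_mod_cast h3
      have hlog3 : Real.log 3 ≤ Real.log a := Real.log_le_log (by norm_num) h3R
      have hlL : (2 * a - 2) * l ≤ (2 * a - 2) * (L / 6) :=
        mul_le_mul_of_nonneg_left (by linarith) (by linarith)
      have ha2 : a * Real.log 2 ≤ a * 0.694 := mul_le_mul_of_nonneg_left (by linarith) ha0.le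
      have haL : 19.77 * a ≤ L * a := mul_le_mul_of_nonneg_right hL3 ha0.le
      linarith
  · have ha2 : a * Real.log 2 ≤ a * 0.694 := mul_le_mul_of_nonneg_left (by linarith) ha0.le
    have hloga2 : Real.log 3 ≤ Real.log a := by
      refine Real.log_le_log (by norm_num) ?_
      linarith
    have hla : (2 * a - 2) * l ≤ 2 * a * l := mul_le_mul_of_nonneg_right (by linarith) hl0
    set X : ℝ := m / a with hX
    have hmX : (m : ℝ) = X * a := by rw [hX]; field_simp
    rcases le_or_gt 4 X with h4 | h4
    · have hX10 : X ≤ 10 := by rw [hX, div_le_iff₀ ha0]; linarith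
      -- Tangent line of the logarithm at `6`.
      have hlX : l ≤ X / 6 + 0.793 := by
        have h1 := Real.log_le_sub_one_of_pos (by positivity : 0 < X / 6)
        rw [Real.log_div (by positivity) (by norm_num), show (6 : ℝ) = 2 * 3 by norm_num,
          Real.log_mul (by norm_num) (by norm_num)] at h1
        linarith
      have hω : 1 - 2 * (a : ℝ) / m = 1 - 2 / X := by
        rw [hmX]; field_simp
      rw [hω] at hW1
      have hX0 : 0 < X := by linarith
      -- Here `324 = 4 * 81`, with `81 ≤ m`.
      have hLa : L / 4 ≤ L * (X * a) / 324 := by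
        rw [← hmX]
        nlinarith
      have hkey := ratio_le_of_mem_Icc h4 hX10 hL3
      have hkey2 := mul_le_mul_of_nonneg_left hkey ha0.le
      have e4 : 0.615 * (L * a * (1 - 2 / X)) =
          a * (L * (0.615 - 1.23 / X - X / 324)) + L * (X * a) / 324 := by
        field_simp
        ring
      have e5 : 2 * a * l ≤ 2 * a * (X / 6 + 0.793) :=
        mul_le_mul_of_nonneg_left hlX (by positivity)
      linarith
    · have hlX : l ≤ 1.3864 := by
        have h1 : l ≤ Real.log ((2 : ℝ) ^ 2) :=
          Real.log_le_log (by positivity) (by norm_num; linarith)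
        rw [Real.log_pow] at h1
        push_cast at h1
        linarith
      have e5 : 2 * a * l ≤ 2 * a * 1.3864 := mul_le_mul_of_nonneg_left hlX (by positivity)
      have ha20 : 20.25 ≤ (a : ℝ) := by nlinarith
      have e6 : 0 ≤ (L - 19.77) * (a - 20.25) := mul_nonneg (by linarith) (by linarith)
      linarith

/-! ### The union bound -/

section Union

variable {n : ℕ} {H : Finset (Fin n)} {k : ℕ}

/-- The pairs of sets for which expansion is required. -/
def ExpansionPair (H A Q : Finset (Fin n)) : Prop :=
  A ⊆ Q ∧ Q ⊆ H ∧ A.Nonempty ∧ Q.card < 2 * A.card ∧ 2 * Q.card ≤ H.card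

/-- Every set makes many selections outside each set less than twice as large. -/
def PicksExpand (L : ℝ) (c : {u // u ∈ H} → Finset (Fin n)) : Prop :=
  ∀ A Q : Finset (Fin n), ExpansionPair H A Q →
    L * A.card * (H.card - Q.card) / H.card / 8 ≤ picks A (H \ Q) c

/-- `Q` is determined by `Q \ A`, which has fewer than `|A|` elements. -/
theorem card_expansionPair_le (A : Finset (Fin n)) (hA : A ⊆ H) (hA1 : 1 ≤ A.card) :
    open Classical in
    ((H.powerset.filter fun Q => ExpansionPair H A Q).card : ℝ) ≤
      Real.exp (A.card + (A.card - 1) * Real.log (H.card / A.card)) := by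
  classical
  refine le_trans (Nat.cast_le.2 ?_) (card_small_subsets_le H hA1 (Finset.card_le_card hA))
  refine Finset.card_le_card_of_injOn (fun Q => Q \ A) ?_ ?_
  · intro Q hQ
    have hQ' := (Finset.mem_filter.1 hQ).2
    refine Finset.mem_coe.2 (Finset.mem_filter.2
      ⟨Finset.mem_powerset.2 (Finset.sdiff_subset.trans hQ'.2.1), ?_⟩)
    rw [Finset.card_sdiff_of_subset hQ'.1]
    have := hQ'.2.2.2.1
    have := Finset.card_le_card hQ'.1
    omega
  · intro Q hQ Q' hQ' h
    have h1 := (Finset.mem_filter.1 hQ).2.1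
    have h2 := (Finset.mem_filter.1 hQ').2.1
    rw [← Finset.sdiff_union_of_subset h1, ← Finset.sdiff_union_of_subset h2]
    exact congrArg (· ∪ A) h

theorem card_not_picksExpand_le (hk : k < n) (hm : 81 ≤ H.card) {L δ : ℝ}
    (hL : L = (k : ℝ) / n * H.card) (hδ : 0 < δ)
    (hL1 : 4 * Real.log (2 * H.card / (3 * δ)) ≤ L) (hL2 : 6 * Real.log (H.card / 3) ≤ L) :
    open Classical in
    (((honestSelections H k).filter fun c => ¬ PicksExpand L c).card : ℝ) ≤
      (honestSelections H k).card * δ := by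
  classical
  have hmn : H.card ≤ n := by
    have := Finset.card_le_univ H
    rwa [Fintype.card_fin] at this
  have hn : 2 ≤ n := by omega
  have hmR : (0 : ℝ) < H.card := by exact_mod_cast (by omega : 0 < H.card)
  have hL0 : 0 ≤ L := by rw [hL]; positivity
  set F := honestSelections H k with hF
  set bad : Finset (Fin n) → Finset (Fin n) → Finset ({u // u ∈ H} → Finset (Fin n)) := fun A Q =>
    F.filter fun c => (picks A (H \ Q) c : ℝ) < L * A.card * (H.card - Q.card) / H.card / 8
    with hbad
  -- `|H \ Q| / |H|` is bounded below in two ways: by `1 - 2a/m`, useful for small `a`, and by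
  -- `1/2`, useful for `a` near `m/2`.
  set W : ℕ → ℝ := fun a =>
    max (0.615 * (L * a * (1 - 2 * a / H.card))) (0.615 * (L * a * (1 / 2))) with hW
  have hsub : (F.filter fun c => ¬ PicksExpand L c) ⊆
      H.powerset.biUnion fun A => (H.powerset.filter fun Q => ExpansionPair H A Q).biUnion
        fun Q => bad A Q := by
    intro c hc
    have hc' := Finset.mem_filter.1 hc
    have h1 := hc'.2
    unfold PicksExpand at h1
    push Not at h1
    obtain ⟨A, Q, hAQ, hlt⟩ := h1
    refine Finset.mem_biUnion.2 ⟨A, Finset.mem_powerset.2 (hAQ.1.trans hAQ.2.1), ?_⟩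
    refine Finset.mem_biUnion.2 ⟨Q, Finset.mem_filter.2 ⟨Finset.mem_powerset.2 hAQ.2.1, hAQ⟩, ?_⟩
    exact Finset.mem_filter.2 ⟨hc'.1, hlt⟩
  have hbadle : ∀ A Q, ExpansionPair H A Q →
      ((bad A Q).card : ℝ) ≤ F.card * Real.exp (-W A.card) := by
    intro A Q hAQ
    have hQm : Q.card ≤ H.card := Finset.card_le_card hAQ.2.1
    have hM : L * A.card * (H.card - Q.card) / H.card =
        (k : ℝ) / n * A.card * (H \ Q).card := by
      rw [Finset.card_sdiff_of_subset hAQ.2.1, Nat.cast_sub hQm, hL]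
      field_simp
    have h1 := card_picks_lt_le (k := k) hk hn (hAQ.1.trans hAQ.2.1)
      (Finset.disjoint_sdiff.mono_left hAQ.1) hM
    refine h1.trans (mul_le_mul_of_nonneg_left (Real.exp_le_exp.2 (neg_le_neg ?_))
      (Nat.cast_nonneg _))
    have h2 : (Q.card : ℝ) ≤ 2 * A.card := by exact_mod_cast hAQ.2.2.2.1.le
    have h3 : 2 * (Q.card : ℝ) ≤ H.card := by exact_mod_cast hAQ.2.2.2.2
    have h4 : L * A.card * (H.card - Q.card) / H.card = L * A.card * (1 - Q.card / H.card) := by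
      field_simp
    have hLA : 0 ≤ L * A.card := by positivity
    rw [h4]
    refine max_le ?_ ?_
    · refine mul_le_mul_of_nonneg_left (mul_le_mul_of_nonneg_left ?_ hLA) (by norm_num)
      gcongr
    · refine mul_le_mul_of_nonneg_left (mul_le_mul_of_nonneg_left ?_ hLA) (by norm_num)
      have : (Q.card : ℝ) / H.card ≤ 1 / 2 := by
        rw [div_le_iff₀ hmR]; linarith
      linarith
  set g : ℕ → ℝ := fun a => if 1 ≤ a ∧ 2 * a ≤ H.card then
    Real.exp (a + (a - 1) * Real.log (H.card / a) - W a) else 0 with hg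
  have hg0 : ∀ a, 0 ≤ g a := by
    intro a
    simp only [hg]
    split_ifs
    · positivity
    · exact le_rfl
  have hinner : ∀ A ∈ H.powerset,
      ((((H.powerset.filter fun Q => ExpansionPair H A Q).biUnion fun Q => bad A Q).card : ℕ) : ℝ) ≤
        F.card * g A.card := by
    intro A hA
    have hAH := Finset.mem_powerset.1 hA
    by_cases hA1 : 1 ≤ A.card ∧ 2 * A.card ≤ H.card
    · have h1 : ((((H.powerset.filter fun Q => ExpansionPair H A Q).biUnion
          fun Q => bad A Q).card : ℕ) : ℝ) ≤
          ∑ Q ∈ H.powerset.filter fun Q => ExpansionPair H A Q, ((bad A Q).card : ℝ) := by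
        exact_mod_cast Finset.card_biUnion_le
      refine h1.trans ((Finset.sum_le_sum fun Q hQ =>
        hbadle A Q (Finset.mem_filter.1 hQ).2).trans ?_)
      rw [Finset.sum_const, nsmul_eq_mul, mul_left_comm]
      refine mul_le_mul_of_nonneg_left ?_ (Nat.cast_nonneg _)
      simp only [hg]
      rw [if_pos hA1, sub_eq_add_neg, Real.exp_add]
      exact mul_le_mul_of_nonneg_right (card_expansionPair_le A hAH hA1.1) (Real.exp_pos _).le
    · have h1 : (H.powerset.filter fun Q => ExpansionPair H A Q) = ∅ := by
        refine Finset.filter_eq_empty_iff.2 fun Q _ hQ => hA1 ⟨hQ.2.2.1.card_pos, ?_⟩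
        have := Finset.card_le_card hQ.1
        have := hQ.2.2.2.2
        omega
      rw [h1]
      simpa using mul_nonneg (Nat.cast_nonneg _) (hg0 _)
  have hterm : ∀ a, (H.card.choose a : ℝ) * g a ≤ if 1 ≤ a then δ * (1 / 2) ^ a else 0 := by
    intro a
    simp only [hg]
    by_cases ha : 1 ≤ a ∧ 2 * a ≤ H.card
    · rw [if_pos ha, if_pos ha.1]
      have h1 := union_exponent_le hm ha.1 ha.2 (W := W a) hδ hL1 hL2 (le_max_left _ _)
        (le_max_right _ _)
      calc _ ≤ Real.exp (a + a * Real.log (H.card / a)) *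
            Real.exp (a + (a - 1) * Real.log (H.card / a) - W a) :=
            mul_le_mul_of_nonneg_right (choose_le_exp ha.1 (by omega)) (Real.exp_pos _).le
        _ = Real.exp (2 * a + (2 * a - 1) * Real.log (H.card / a) - W a) := by
            rw [← Real.exp_add]
            congr 1
            ring
        _ ≤ Real.exp (Real.log δ - a * Real.log 2) := Real.exp_le_exp.2 h1
        _ = δ * (1 / 2) ^ a := by
            rw [Real.exp_sub, Real.exp_log hδ, Real.exp_nat_mul, Real.exp_log (by norm_num),
              one_div, inv_pow, div_eq_mul_inv]
    · rw [if_neg ha, mul_zero]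
      split_ifs <;> positivity
  calc (((F.filter fun c => ¬ PicksExpand L c).card : ℕ) : ℝ)
      ≤ ((H.powerset.biUnion fun A => (H.powerset.filter fun Q => ExpansionPair H A Q).biUnion
        fun Q => bad A Q).card : ℝ) := Nat.cast_le.2 (Finset.card_le_card hsub)
    _ ≤ ∑ A ∈ H.powerset, ((((H.powerset.filter fun Q => ExpansionPair H A Q).biUnion
          fun Q => bad A Q).card : ℕ) : ℝ) := by exact_mod_cast Finset.card_biUnion_le
    _ ≤ ∑ A ∈ H.powerset, F.card * g A.card := Finset.sum_le_sum hinner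
    _ = F.card * ∑ a ∈ Finset.range (H.card + 1), (H.card.choose a : ℝ) * g a := by
        rw [← Finset.mul_sum, Finset.sum_powerset_apply_card]
        simp only [nsmul_eq_mul]
    _ ≤ F.card * ∑ a ∈ Finset.range (H.card + 1), (if 1 ≤ a then δ * (1 / 2) ^ a else 0) :=
        mul_le_mul_of_nonneg_left (Finset.sum_le_sum fun a _ => hterm a) (Nat.cast_nonneg _)
    _ ≤ F.card * δ := by
        refine mul_le_mul_of_nonneg_left ?_ (Nat.cast_nonneg _)
        rw [Finset.sum_range_succ']
        have h2 : ∀ a : ℕ, (if 1 ≤ a + 1 then δ * (1 / 2 : ℝ) ^ (a + 1) else 0) =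
            (1 / 2 : ℝ) ^ a * (δ / 2) := by
          intro a
          rw [if_pos (by omega), pow_succ]
          ring
        simp_rw [h2]
        rw [← Finset.sum_mul, if_neg (by norm_num), add_zero]
        have := mul_le_mul_of_nonneg_right (sum_geometric_two_le H.card)
          (by positivity : 0 ≤ δ / 2)
        linarith

end Union

/-! ### The energy bound -/

theorem inv_pow_le_exp_neg {x : ℝ} {j : ℕ} (hx : x ≤ j) :
    (1 / 1.1814 : ℝ) ^ j ≤ Real.exp (-(x / 6)) := by
  have h1 : Real.exp (1 / 6) ≤ 1.1814 := by
    have h2 : Real.exp (1 / 6) ^ 6 = Real.exp 1 := by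
      rw [← Real.exp_nat_mul]
      norm_num
    have h3 := Real.exp_one_lt_d9
    refine le_of_pow_le_pow_left₀ (n := 6) (by norm_num) (by norm_num) ?_
    rw [h2]
    norm_num at h3 ⊢
    linarith
  have h2 : Real.exp (-((j : ℝ) / 6)) ≤ Real.exp (-(x / 6)) := Real.exp_le_exp.2 (by linarith)
  refine le_trans ?_ h2
  rw [show -((j : ℝ) / 6) = (j : ℕ) * (-(1 / 6) : ℝ) by ring, Real.exp_nat_mul, Real.exp_neg,
    ← one_div]
  exact pow_le_pow_left₀ (by norm_num) (one_div_le_one_div_of_le (Real.exp_pos _) h1) _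

theorem main_terms_le_of_cubic {L h : ℝ} (hL : 3 < L)
    (hc : 0 ≤ h * L ^ 3 + (1.113 - 3 * h) * L ^ 2 - 58.339 * L + 192) :
    64 / L ^ 2 + 1.887 / L ≤ 3 / (L - 3) + h := by
  have hL3 : 0 < L - 3 := by linarith
  have hL0 : 0 < L := by linarith
  rw [← sub_nonneg]
  have : 3 / (L - 3) + h - (64 / L ^ 2 + 1.887 / L) =
      (h * L ^ 3 + (1.113 - 3 * h) * L ^ 2 - 58.339 * L + 192) / (L ^ 2 * (L - 3)) := by
    field_simp
    ring
  rw [this]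
  positivity

/-- The leading energy terms exceed `3 / (L - 3)` only for moderate `L`; there the exponential,
later traded for a multiple of `1 / m`, covers the excess. -/
theorem main_terms_le {L : ℝ} (hL : 19.77 ≤ L) :
    64 / L ^ 2 + 1.887 / L ≤ 3 / (L - 3) + 8.28 * Real.exp (-(L / 6)) := by
  -- On `[lo, j]` the exponential is replaced by a constant `h` below it. The cubic left after
  -- clearing denominators then has nonnegative Taylor coefficients at `lo`.
  have key : ∀ (lo : ℝ) (j : ℕ) (h : ℝ), lo ≤ L → L ≤ j → h ≤ 8.28 * (1 / 1.1814 : ℝ) ^ j →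
      0 ≤ h → 0 ≤ h * lo ^ 3 + (1.113 - 3 * h) * lo ^ 2 - 58.339 * lo + 192 →
      0 ≤ 3 * h * lo ^ 2 + 2 * (1.113 - 3 * h) * lo - 58.339 → 0 ≤ 3 * h * lo + 1.113 - 3 * h →
      64 / L ^ 2 + 1.887 / L ≤ 3 / (L - 3) + 8.28 * Real.exp (-(L / 6)) := by
    intro lo j h h1 h2 h3 h4 h5 h6 h7
    have h8 := inv_pow_le_exp_neg h2
    have h9 : 64 / L ^ 2 + 1.887 / L ≤ 3 / (L - 3) + h := by
      refine main_terms_le_of_cubic (by linarith) ?_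
      obtain ⟨t, ht⟩ : ∃ t, t = L - lo := ⟨_, rfl⟩
      have ht0 : 0 ≤ t := by linarith
      have hLt : L = lo + t := by linarith
      have e : h * L ^ 3 + (1.113 - 3 * h) * L ^ 2 - 58.339 * L + 192 =
          (h * lo ^ 3 + (1.113 - 3 * h) * lo ^ 2 - 58.339 * lo + 192) +
          (3 * h * lo ^ 2 + 2 * (1.113 - 3 * h) * lo - 58.339) * t +
          (3 * h * lo + 1.113 - 3 * h) * t ^ 2 + h * t ^ 3 := by
        rw [hLt]; ring
      rw [e]
      positivity
    linarith
  rcases le_or_gt 49 L with h0 | h0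
  · have h9 : 64 / L ^ 2 + 1.887 / L ≤ 3 / (L - 3) + 0 := by
      refine main_terms_le_of_cubic (by linarith) ?_
      nlinarith
    have := Real.exp_pos (-(L / 6))
    linarith
  rcases le_or_gt 46 L with h1 | h1
  · exact key 46 49 0.002 h1 (by norm_num; linarith) (by norm_num) (by norm_num) (by norm_num)
      (by norm_num) (by norm_num)
  rcases le_or_gt 44 L with h2 | h2
  · exact key 44 46 0.0034 h2 (by norm_num; linarith) (by norm_num) (by norm_num) (by norm_num)
      (by norm_num) (by norm_num)
  rcases le_or_gt 42 L with h3 | h3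
  · exact key 42 44 0.005 h3 (by norm_num; linarith) (by norm_num) (by norm_num) (by norm_num)
      (by norm_num) (by norm_num)
  rcases le_or_gt 39 L with h4 | h4
  · exact key 39 42 0.0074 h4 (by norm_num; linarith) (by norm_num) (by norm_num) (by norm_num)
      (by norm_num) (by norm_num)
  rcases le_or_gt 36 L with h5 | h5
  · exact key 36 39 0.012 h5 (by norm_num; linarith) (by norm_num) (by norm_num) (by norm_num)
      (by norm_num) (by norm_num)
  rcases le_or_gt 32 L with h6 | h6
  · exact key 32 36 0.02 h6 (by norm_num; linarith) (by norm_num) (by norm_num) (by norm_num)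
      (by norm_num) (by norm_num)
  rcases le_or_gt 27 L with h7 | h7
  · exact key 27 32 0.036 h7 (by norm_num; linarith) (by norm_num) (by norm_num) (by norm_num)
      (by norm_num) (by norm_num)
  · exact key 19.77 27 0.09 hL (by norm_num; linarith) (by norm_num) (by norm_num) (by norm_num)
      (by norm_num) (by norm_num)

/-- With degree `0.78 L` and `J` about `L / 4`, the first denominator exceeds `0.53 L` (hence
`1.887`), and the geometric sum gives `64 / L ^ 2`. The rest is absorbed in `(12 + 6 log m) / m`. -/
theorem energy_bound_le {m J : ℕ} (hm : 81 ≤ m) {L : ℝ} (hL : 19.77 ≤ L)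
    (hL2 : 6 * Real.log (m / 3) ≤ L) (hJ1 : L / 4 ≤ J) (hJ2 : J < L / 4 + 1) :
    1 / (0.78 * L + 1 - J) + (2 / J + 4 * (Nat.log 2 m : ℝ) / m) / (L / 8) + 8 / (L / 8 * m) ≤
      3 / (L - 3) + (12 + 6 * Real.log m) / m := by
  have hmR : (81 : ℝ) ≤ m := by exact_mod_cast hm
  have hm0 : (0 : ℝ) < m := by linarith
  have hL0 : 0 < L := by linarith
  have hJ0 : (0 : ℝ) < J := by linarith
  have hlogm : 4.394 ≤ Real.log m := by
    have h1 : Real.log ((3 : ℝ) ^ 4) ≤ Real.log m :=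
      Real.log_le_log (by norm_num) (by norm_num; linarith)
    rw [Real.log_pow] at h1
    push_cast at h1
    linarith [log_three_gt]
  have hN : (Nat.log 2 m : ℝ) ≤ 1.4429 * Real.log m := by
    have h1 : ((2 : ℝ) ^ Nat.log 2 m) ≤ m := by
      exact_mod_cast Nat.pow_log_le_self 2 (by omega)
    have h2 := Real.log_le_log (by positivity) h1
    rw [Real.log_pow] at h2
    have h3 := Real.log_two_gt_d9
    have h4 : (0 : ℝ) ≤ Nat.log 2 m := Nat.cast_nonneg _
    nlinarith
  have hmexp : 8.28 * Real.exp (-(L / 6)) ≤ 24.84 / m := by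
    have h1 : (m : ℝ) / 3 ≤ Real.exp (L / 6) := by
      rw [← Real.exp_log (by positivity : (0 : ℝ) < m / 3)]
      exact Real.exp_le_exp.2 (by linarith)
    rw [Real.exp_neg]
    have h2 : (Real.exp (L / 6))⁻¹ ≤ (m / 3 : ℝ)⁻¹ := inv_anti₀ (by positivity) h1
    have h3 : (24.84 : ℝ) / m = 8.28 * (m / 3 : ℝ)⁻¹ := by field_simp; norm_num
    rw [h3]
    linarith
  have hmain := main_terms_le hL
  have t1 : 1 / (0.78 * L + 1 - J) ≤ 1.887 / L := by
    rw [div_le_div_iff₀ (by linarith) hL0]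
    linarith
  have t2 : 2 / (J : ℝ) ≤ 8 / L := by
    rw [div_le_div_iff₀ hJ0 hL0]
    linarith
  have hLinv : 1 / L ≤ 1 / 19.77 := one_div_le_one_div_of_le (by norm_num) hL
  have t3 : (2 / J + 4 * (Nat.log 2 m : ℝ) / m) / (L / 8) ≤
      64 / L ^ 2 + 2.336 * Real.log m / m := by
    have e1 : (2 / J + 4 * (Nat.log 2 m : ℝ) / m) / (L / 8) =
        8 / L * (2 / J) + 32 * (Nat.log 2 m : ℝ) / m * (1 / L) := by
      field_simp
      ring
    have e2 : 8 / L * (2 / (J : ℝ)) ≤ 64 / L ^ 2 := by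
      calc 8 / L * (2 / (J : ℝ)) ≤ 8 / L * (8 / L) := by gcongr
        _ = _ := by field_simp; norm_num
    have e3 : 32 * (Nat.log 2 m : ℝ) / m * (1 / L) ≤ 2.336 * Real.log m / m := by
      calc 32 * (Nat.log 2 m : ℝ) / m * (1 / L) ≤
            32 * (1.4429 * Real.log m) / m * (1 / 19.77) := by gcongr
        _ = (32 * 1.4429 / 19.77) * Real.log m / m := by ring
        _ ≤ _ := by
            gcongr
            norm_num
    linarith
  have t4 : 8 / (L / 8 * m) ≤ 3.24 / m := by
    have e1 : 8 / (L / 8 * m) = 64 / m * (1 / L) := by field_simp; norm_num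
    rw [e1]
    calc 64 / (m : ℝ) * (1 / L) ≤ 64 / m * (1 / 19.77) := by gcongr
      _ ≤ _ := by
          rw [div_mul_eq_mul_div]
          gcongr
          norm_num
  -- Nearly tight: `28.08 - 12 ≤ 3.664 log m` at `log m ≥ 4.394`, that is, from `m ≥ 81`.
  have t5 : 24.84 / (m : ℝ) + 2.336 * Real.log m / m + 3.24 / m ≤ (12 + 6 * Real.log m) / m := by
    rw [← add_div, ← add_div]
    refine div_le_div_of_nonneg_right ?_ hm0.le
    linarith
  linarith

/-! ### Privacy of the whole process -/

section Graph

variable {n : ℕ} {H : Finset (Fin n)}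

theorem graphOf_adj (c : Fin n → Finset (Fin n)) (u w : Fin n) :
    (graphOf c).Adj u w ↔ u ≠ w ∧ (w ∈ c u ∨ u ∈ c w) := by
  rw [graphOf, SimpleGraph.fromRel_adj]

theorem expands_of_picksExpand {L : ℝ} {c : Fin n → Finset (Fin n)}
    (h : PicksExpand L fun u : {u // u ∈ H} => c u.1) : Expands H (graphOf c) (L / 8) := by
  classical
  intro A Q hAQ hQH hA hQA hQm
  have h1 := h A Q ⟨hAQ, hQH, hA, hQA, hQm⟩
  have e : L / 8 * A.card * (H.card - Q.card) / H.card =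
      L * A.card * (H.card - Q.card) / H.card / 8 := by ring
  rw [e]
  refine h1.trans (Nat.cast_le.2 ?_)
  have e2 : picks A (H \ Q) (fun u : {u // u ∈ H} => c u.1) =
      ∑ u ∈ A, (c u ∩ (H \ Q)).card := by
    unfold picks
    rw [Finset.sum_coe_sort H (fun u => if u ∈ A then (c u ∩ (H \ Q)).card else 0),
      Finset.sum_ite_mem, Finset.inter_eq_right.2 (hAQ.trans hQH)]
  rw [e2, Finset.card_filter, Finset.sum_product]
  refine Finset.sum_le_sum fun u hu => ?_
  rw [← Finset.card_filter]
  refine Finset.card_le_card fun w hw => ?_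
  rw [Finset.mem_inter] at hw
  refine Finset.mem_filter.2 ⟨hw.2, (graphOf_adj c u w).2 ⟨?_, Or.inl hw.1⟩⟩
  rintro rfl
  exact (Finset.mem_sdiff.1 hw.2).2 (hAQ hu)

theorem honestDegree_le_card (c : Fin n → Finset (Fin n)) (v : {u // u ∈ H}) :
    open Classical in
    honestDegree v (fun u : {u // u ∈ H} => c u.1) ≤
      (H.filter fun w => (graphOf c).Adj v w).card := by
  classical
  unfold honestDegree
  refine Finset.card_le_card_of_injOn (fun w => w.1) ?_ fun a _ b _ h => Subtype.ext h
  intro w hw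
  have hw' := Finset.mem_filter.1 hw
  refine Finset.mem_coe.2 (Finset.mem_filter.2 ⟨w.2, (graphOf_adj c v w).2 ⟨?_, hw'.2⟩⟩)
  intro h
  exact (Finset.mem_erase.1 hw'.1).1 (Subtype.ext h.symm)

end Graph

theorem selectionLaw_map_restrict {n : ℕ} (H : Finset (Fin n)) (k : ℕ) (hk : k < n)
    (adv : Strategy H) :
    (selectionLaw H k hk adv).map (fun c (u : {u // u ∈ H}) => c u.1) =
      PMF.uniformOfFinset (honestSelections H k) (honestSelections_nonempty H hk) := by
  unfold selectionLaw
  rw [PMF.map_bind]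
  simp_rw [PMF.map_comp]
  refine (congrArg _ (funext fun c => ?_)).trans (PMF.bind_pure _)
  have : ((fun c (u : {u // u ∈ H}) => c u.1) ∘
      fun (d : {u // u ∉ H} → Finset (Fin n)) u => if h : u ∈ H then c ⟨u, h⟩ else d ⟨u, h⟩) =
      Function.const _ c := by
    funext d u
    simp
  rw [this, PMF.map_const]

/-- The honest marginal is uniform for every strategy, so an event about honest selections has the
same probability against every adversary. -/
theorem tsum_selectionLaw_bad_le {n : ℕ} (H : Finset (Fin n)) (k : ℕ) (hk : k < n)
    (adv : Strategy H) (bad : ({u // u ∈ H} → Finset (Fin n)) → Prop) [DecidablePred bad] {β : ℝ}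
    (hβ : (((honestSelections H k).filter bad).card : ℝ) ≤ (honestSelections H k).card * β) :
    ∑' c : Fin n → Finset (Fin n), (if bad (fun u => c u.1) then selectionLaw H k hk adv c else 0) ≤
      ENNReal.ofReal β := by
  have hpos : (0 : ℝ) < (honestSelections H k).card := by
    exact_mod_cast (honestSelections_nonempty H hk).card_pos
  have h1 : (selectionLaw H k hk adv).toOuterMeasure
      ((fun c (u : {u // u ∈ H}) => c u.1) ⁻¹' {c | bad c}) =
      ((honestSelections H k).filter bad).card / (honestSelections H k).card := by
    rw [← PMF.toOuterMeasure_map_apply, selectionLaw_map_restrict,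
      PMF.toOuterMeasure_uniformOfFinset_apply]
    congr!
  rw [PMF.toOuterMeasure_apply] at h1
  have h2 : ∑' c : Fin n → Finset (Fin n),
      (if bad (fun u => c u.1) then selectionLaw H k hk adv c else 0) =
      ((honestSelections H k).filter bad).card / (honestSelections H k).card := by
    rw [← h1]
    refine tsum_congr fun c => ?_
    by_cases hc : bad fun u => c u.1
    · rw [if_pos hc]
      exact (Set.indicator_of_mem (s := (fun (c : Fin n → Finset (Fin n)) (u : {u // u ∈ H}) => c u.1) ⁻¹'
        {c | bad c}) hc _).symm
    · rw [if_neg hc]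
      exact (Set.indicator_of_notMem (s := (fun (c : Fin n → Finset (Fin n)) (u : {u // u ∈ H}) => c u.1) ⁻¹'
        {c | bad c}) hc _).symm
  rw [h2]
  have h3 : ((honestSelections H k).filter bad).card / ((honestSelections H k).card : ℝ) ≤ β := by
    rw [div_le_iff₀ hpos]
    linarith
  refine le_trans (le_of_eq ?_) (ENNReal.ofReal_le_ofReal h3)
  rw [ENNReal.ofReal_div_of_pos hpos, ENNReal.ofReal_natCast, ENNReal.ofReal_natCast]

theorem gopaOn_apply_le_one {n : ℕ} (H : Finset (Fin n)) (ση σΔ : ℝ≥0) (G : SimpleGraph (Fin n))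
    (X : Dataset n) (O : Set (View H)) : gopaOn H ση σΔ G X O ≤ 1 := by
  have : IsProbabilityMeasure (gopaOn H ση σΔ G X) :=
    Measure.isProbabilityMeasure_map (measurable_view H G X).aemeasurable
  exact prob_le_one

/-- The graph law does not depend on the dataset, so the fixed-graph inequality can be averaged; bad
selections are bounded by their probability. -/
theorem gopaKOut_le_of_good {n : ℕ} {H : Finset (Fin n)} {k : ℕ} (hk : k < n) (adv : Strategy H)
    {ση σΔ : ℝ≥0} {X X' : Dataset n} {O : Set (View H)} (hO : MeasurableSet O)
    (bad : ({u // u ∈ H} → Finset (Fin n)) → Prop) [DecidablePred bad] {β τ ε : ℝ}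
    (hβ : (((honestSelections H k).filter bad).card : ℝ) ≤ (honestSelections H k).card * β)
    (hgood : ∀ c : Fin n → Finset (Fin n), ¬ bad (fun u => c u.1) →
      gopaOn H ση σΔ (graphOf c) X O ≤
        ENNReal.ofReal (Real.exp ε) * gopaOn H ση σΔ (graphOf c) X' O + ENNReal.ofReal τ) :
    gopaKOut H k hk adv ση σΔ X O ≤ ENNReal.ofReal (Real.exp ε) * gopaKOut H k hk adv ση σΔ X' O +
      (ENNReal.ofReal τ + ENNReal.ofReal β) := by
  unfold gopaKOut
  rw [Measure.sum_apply _ hO, Measure.sum_apply _ hO]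
  simp only [Measure.smul_apply, smul_eq_mul]
  set p := selectionLaw H k hk adv with hp
  have hterm : ∀ c, p c * gopaOn H ση σΔ (graphOf c) X O ≤
      ENNReal.ofReal (Real.exp ε) * (p c * gopaOn H ση σΔ (graphOf c) X' O) +
        (p c * ENNReal.ofReal τ + if bad (fun u => c u.1) then p c else 0) := by
    intro c
    by_cases hc : bad (fun u => c u.1)
    · rw [if_pos hc]
      calc p c * gopaOn H ση σΔ (graphOf c) X O ≤ p c * 1 := by
            gcongr
            exact gopaOn_apply_le_one _ _ _ _ _ _
        _ ≤ _ := by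
            rw [mul_one, ← add_assoc]
            exact le_add_self
    · rw [if_neg hc, add_zero]
      calc p c * gopaOn H ση σΔ (graphOf c) X O ≤ p c *
            (ENNReal.ofReal (Real.exp ε) * gopaOn H ση σΔ (graphOf c) X' O + ENNReal.ofReal τ) :=
            mul_le_mul_right (hgood c hc) _
        _ = _ := by ring
  refine (ENNReal.tsum_le_tsum hterm).trans ?_
  rw [ENNReal.tsum_add, ENNReal.tsum_add, ENNReal.tsum_mul_left, ENNReal.tsum_mul_right,
    PMF.tsum_coe, one_mul]
  gcongr
  exact tsum_selectionLaw_bad_le H k hk adv bad hβ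

/-- The Chernoff bound for the privacy loss, under the calibration of the Gaussian mechanism. -/
theorem exp_neg_le_of_calibration {ε δ θ : ℝ} (hδ : 0 < δ) (hθ : 0 < θ)
    (h : 2 * Real.log (2 / (δ * Real.sqrt (2 * Real.pi))) * θ ≤ (ε - θ / 2) ^ 2) :
    Real.exp (-((ε - θ / 2) ^ 2 / (2 * θ))) ≤ 1.3 * δ := by
  have hs : 0 < Real.sqrt (2 * Real.pi) := Real.sqrt_pos.2 (by positivity)
  have hs2 : Real.sqrt (2 * Real.pi) ≤ 2.6 := by
    rw [Real.sqrt_le_left (by norm_num)]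
    have := Real.pi_lt_d2
    norm_num at this ⊢
    linarith
  -- The bound `2.6` on `√(2π)`, halved, is the factor `1.3`.
  have h1 : Real.log (2 / (δ * Real.sqrt (2 * Real.pi))) ≤ (ε - θ / 2) ^ 2 / (2 * θ) := by
    rw [le_div_iff₀ (by positivity)]
    linarith
  calc Real.exp (-((ε - θ / 2) ^ 2 / (2 * θ)))
      ≤ Real.exp (-Real.log (2 / (δ * Real.sqrt (2 * Real.pi)))) := Real.exp_le_exp.2 (by linarith)
    _ = δ * Real.sqrt (2 * Real.pi) / 2 := by
        rw [← Real.log_inv, Real.exp_log (by positivity), inv_div]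
    _ ≤ 1.3 * δ := by nlinarith

theorem exists_honestFlow_of_good {n : ℕ} {H : Finset (Fin n)} (hm : 81 ≤ H.card)
    {L : ℝ} (hL : 19.77 ≤ L) (hL2 : 6 * Real.log (H.card / 3) ≤ L) {c : Fin n → Finset (Fin n)}
    {v : {u // u ∈ H}} (hdeg : 0.78 * L ≤ honestDegree v fun u : {u // u ∈ H} => c u.1)
    (hexp : PicksExpand L fun u : {u // u ∈ H} => c u.1) :
    ∃ y, IsHonestFlow H (graphOf c) v y ∧
      ∑ e, y e ^ 2 ≤ 3 / (L - 3) + (12 + 6 * Real.log H.card) / H.card := by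
  classical
  have hm0 : (0 : ℝ) < H.card := by exact_mod_cast (by omega : 0 < H.card)
  set J := ⌈L / 4⌉₊ with hJ
  have hJ1 : L / 4 ≤ J := Nat.le_ceil _
  have hJ2 : (J : ℝ) < L / 4 + 1 := Nat.ceil_lt_add_one (by linarith)
  have hJ3 : 2 ≤ J := by
    have : (2 : ℝ) ≤ J := by linarith
    exact_mod_cast this
  have hJd : (J : ℝ) < 0.78 * L + 1 := by linarith
  have hd : 0.78 * L ≤ (H.filter fun w => (graphOf c).Adj v w).card :=
    hdeg.trans (Nat.cast_le.2 (honestDegree_le_card c v))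
  have hJ0 : (0 : ℝ) < J := by linarith
  obtain ⟨y, hy, hyR⟩ := exists_honestFlow
    (add_nonneg (add_nonneg (div_nonneg zero_le_one (by linarith : 0 ≤ 0.78 * L + 1 - J))
      (by positivity)) (by positivity))
    ((expands_of_picksExpand hexp).potential_bound (by linarith) v.2 hJ3 hJd hd)
  exact ⟨y, hy, hyR.trans (energy_bound_le hm hL hL2 hJ1 hJ2)⟩

end Gopa

theorem theorem3 (n k : ℕ) (hk : k < n) (H : Finset (Fin n)) (ρ : ℝ)
    (hρ : ρ = (H.card : ℝ) / (n : ℝ))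
    (ε δ : ℝ) (hε : 0 < ε) (hε1 : ε < 1) (hδ : 0 < δ) (hδ1 : δ < 1)
    (ση σΔ : ℝ≥0) (hση : 0 < ση) (hσΔ : 0 < σΔ)
    (hn : 81 ≤ ρ * n)
    (hk1 : 4 * Real.log (2 * (ρ * n) / (3 * δ)) ≤ ρ * k)
    (hk2 : 6 * Real.log (ρ * n / 3) ≤ ρ * k)
    (hk3 : 3 / 2 + 9 / 4 * Real.log (2 * Real.exp 1 / δ) ≤ ρ * k)
    (θ : ℝ)
    (hθ : θ = 1 / ((H.card : ℝ) * (ση : ℝ) ^ 2) +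
      (1 / ((⌊((k : ℝ) - 1) * ρ / 3⌋ : ℝ) - 1) +
        (12 + 6 * Real.log (H.card : ℝ)) / (H.card : ℝ)) / (σΔ : ℝ) ^ 2)
    (h1 : θ / 2 + Real.sqrt θ ≤ ε)
    (h2 : 2 * Real.log (2 / (δ * Real.sqrt (2 * Real.pi))) * θ ≤ (ε - θ / 2) ^ 2)
    (adv : Gopa.Strategy H) :
    Gopa.IsDP (Gopa.HonestNeighbors H) (Gopa.gopaKOut H k hk adv ση σΔ) ε (3 * δ) := by
  classical
  have hn0 : (0 : ℝ) < n := by exact_mod_cast (by omega : 0 < n)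
  have hρn : ρ * n = H.card := by rw [hρ]; field_simp
  rw [hρn] at hn hk1 hk2
  have hm : 81 ≤ H.card := by exact_mod_cast hn
  have hm0 : (0 : ℝ) < H.card := by linarith
  obtain ⟨L, hLdef⟩ : ∃ L, L = ρ * k := ⟨_, rfl⟩
  rw [← hLdef] at hk1 hk2
  have hL : L = (k : ℝ) / n * H.card := by rw [hLdef, hρ]; ring
  -- From `|H| / 3 ≥ 27` and `6 * log 27 = 18 log 3`.
  have hL3 : 19.77 ≤ L := by
    have h3 : Real.log ((3 : ℝ) ^ 3) ≤ Real.log (H.card / 3) :=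
      Real.log_le_log (by norm_num) (by rw [le_div_iff₀ (by norm_num)]; linarith)
    rw [Real.log_pow] at h3
    push_cast at h3
    linarith [Gopa.log_three_gt]
  have hρ1 : ρ ≤ 1 := by
    rw [hρ, div_le_one hn0]
    have := Finset.card_le_univ H
    rw [Fintype.card_fin] at this
    exact_mod_cast this
  have hρ0 : 0 ≤ ρ := by rw [hρ]; positivity
  -- The floor is at most `(L - ρ) / 3 ≤ L / 3`, and `L ≥ 19.77` keeps the floor minus one positive.
  have hfloor : 3 / (L - 3) ≤ 1 / ((⌊((k : ℝ) - 1) * ρ / 3⌋ : ℝ) - 1) := by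
    have e : ((k : ℝ) - 1) * ρ / 3 = (L - ρ) / 3 := by rw [hLdef]; ring
    have f1 := Int.floor_le (((k : ℝ) - 1) * ρ / 3)
    have f2 := Int.lt_floor_add_one (((k : ℝ) - 1) * ρ / 3)
    rw [e] at f1 f2
    rw [e, div_le_div_iff₀ (by linarith) (by linarith)]
    linarith
  have hση' : (0 : ℝ) < ση := hση
  have hσΔ' : (0 : ℝ) < σΔ := hσΔ
  have hlogm : 0 ≤ Real.log H.card := Real.log_nonneg (by linarith)
  have hθ0 : 0 < θ := by
    rw [hθ]
    have : 0 ≤ 3 / (L - 3) := div_nonneg (by norm_num) (by linarith)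
    have := this.trans hfloor
    positivity
  have hεθ : θ / 2 ≤ ε := by linarith [Real.sqrt_nonneg θ]
  intro X X' hX O hO
  obtain ⟨v, hv, hXv⟩ := hX
  -- Only the degree of the user `v` whose value changes matters, so no union bound over users is
  -- needed.
  set bad : ({u // u ∈ H} → Finset (Fin n)) → Prop := fun c =>
    (Gopa.honestDegree ⟨v, hv⟩ c : ℝ) < 0.78 * L ∨ ¬ Gopa.PicksExpand L c with hbad
  have hcard : (((Gopa.honestSelections H k).filter bad).card : ℝ) ≤
      (Gopa.honestSelections H k).card * (1.2 * δ) := by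
    have b1 := Gopa.card_honestDegree_lt_le hk (by
      have := Finset.card_le_univ H
      rw [Fintype.card_fin] at this
      omega) ⟨v, hv⟩ hL
    have b2 := Gopa.card_not_picksExpand_le hk hm hL hδ hk1 hk2
    have b3 : Real.exp (1.51 - L / 4) ≤ 0.2 * δ := by
      have e1 : Real.exp (-(L / 4)) ≤ δ / 54 := by
        calc Real.exp (-(L / 4)) ≤ Real.exp (-Real.log (2 * H.card / (3 * δ))) :=
              Real.exp_le_exp.2 (by linarith)
          _ = 3 * δ / (2 * H.card) := by
              rw [← Real.log_inv, Real.exp_log (by positivity), inv_div]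
          _ ≤ δ / 54 := by
              rw [div_le_div_iff₀ (by positivity) (by norm_num)]
              nlinarith
      have e2 : Real.exp 1.51 ≤ 7.4 := by
        calc Real.exp 1.51 ≤ Real.exp ((2 : ℕ) * 1) := Real.exp_le_exp.2 (by norm_num)
          _ = Real.exp 1 ^ 2 := Real.exp_nat_mul _ _
          _ ≤ 2.72 ^ 2 := by
              refine pow_le_pow_left₀ (Real.exp_pos _).le ?_ 2
              have := Real.exp_one_lt_d9
              norm_num at this ⊢
              linarith
          _ ≤ 7.4 := by norm_num
      rw [sub_eq_add_neg, Real.exp_add]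
      calc _ ≤ 7.4 * (δ / 54) := by gcongr
        _ ≤ _ := by linarith
    rw [Finset.filter_or]
    have b4 : (((Gopa.honestSelections H k).filter fun c =>
        (Gopa.honestDegree ⟨v, hv⟩ c : ℝ) < 0.78 * L).card : ℝ) +
        ((Gopa.honestSelections H k).filter fun c => ¬ Gopa.PicksExpand L c).card ≤
        (Gopa.honestSelections H k).card * (1.2 * δ) := by
      have := mul_le_mul_of_nonneg_left b3
        (Nat.cast_nonneg (α := ℝ) (Gopa.honestSelections H k).card)
      linarith
    refine le_trans ?_ b4
    exact_mod_cast Finset.card_union_le _ _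
  have hmain := Gopa.gopaKOut_le_of_good (ση := ση) (σΔ := σΔ) (X := X) (X' := X') (ε := ε) hk adv hO
    bad (β := 1.2 * δ) (τ := 1.3 * δ) hcard fun c hc => by
      simp only [hbad, not_or, not_lt, not_not] at hc
      obtain ⟨y, hy, hyR⟩ := Gopa.exists_honestFlow_of_good hm hL3 hk2 hc.1 hc.2
      have hbound := Gopa.gopaOn_le_of_flow hv hy hXv hση hσΔ (θ := θ) (ε := ε) (by
        rw [hθ]
        gcongr
        linarith) hεθ hO
      refine hbound.trans ?_
      gcongr
      exact Gopa.exp_neg_le_of_calibration hδ hθ0 h2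
  refine hmain.trans ?_
  gcongr
  rw [← ENNReal.ofReal_add (by positivity) (by positivity)]
  -- `1.3 + 1.2 = 2.5 ≤ 3`.
  exact ENNReal.ofReal_le_ofReal (by linarith)
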